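/- Let $d\ge 2$ be an integer, let $\gamma>0$ and $q\in[1,\infty)$. Let $K\subset\mathbb R^d$ be a closed polytopic mesh element with diameter $h_K$ satisfying the following regularity assumptions: $K$ is the union of a finite family $\mathfrak T_K$ of closed nondegenerate $d$-simplices with pairwise disjoint interiors such that, for every $T\in\mathfrak T_K$, each facet of $T$ is either contained in $\partial K$ or meets $\partial K$ in a set of zero $(d-1)$-dimensional Hausdorff measure, and, whenever $F_K^T:=\partial T\cap\partial K$ is not empty, $$\gamma\, h_K\le d\,|T|\,|F_K^T|^{-1},$$ where $|T|$ is the volume of $T$, $|F_K^T|$ is the $(d-1)$-dimensional Hausdorff measure of $F_K^T$ (normalized to be Lebesgue measure on hyperplanes), and the right-hand side is $+\infty$ if $|F_K^T|=0$. For $q\le s<\infty$ put $$C_{tr}(q,s,d,\gamma):=\left(\frac{d\,\pi^{\frac{d(s-q)}{2s}}}{\gamma\,\Gamma\left(\frac d2+1\right)^{\frac{s-q}{s}}}+\frac{q-1}{\gamma}\right)^{\frac1q},$$ and let $\frac1{q'}:=1-\frac1q$ and, if $q<d$, $q^*:=\frac{qd}{d-q}$ and $q^\sharp:=\frac{q(d-1)}{d-q}$.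 Write $W^{1,q}(K)$ for the space of functions in $L^q(K)$ with distributional gradient (in the interior of $K$) in $L^q(K)$, with $\|\nabla v\|_{L^q(K)}$ the $L^q$ norm of the Euclidean length $|\nabla v|$. Then every $v\in W^{1,q}(K)$ has a trace on $\partial K$, i.e. a function in $L^q(\partial K)$, still denoted by $v$, unique up to null sets, such that $\lim_{r\to0^+}\frac{1}{|K\cap B(x,r)|}\int_{K\cap B(x,r)}|v(y)-v(x)|\,dy=0$ for almost every $x\in\partial K$ (the restriction of $v$ to $\partial K$ if $v$ is continuous on $K$), and $$\|v\|_{L^q(\partial K)}\le C_{tr}(q,q,d,\gamma)\left(h_K^{-\frac1q}\|v\|_{L^q(K)}+h_K^{\frac1{q'}}\|\nabla v\|_{L^q(K)}\right).$$ If moreover $q<d$, then, with norms taken in $[0,\infty]$, $$\|v\|_{L^{q^\sharp}(\partial K)}\le C_{tr}(q^\sharp,q^*,d,\gamma)\left(\|v\|_{L^{q^*}(K)}+\|\nabla v\|_{L^q(K)}\right).$$ -/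

import Mathlib

open MeasureTheory Filter Topology Set
open scoped ENNReal ContDiff

noncomputable section

namespace SobolevTrace

/-- The Euclidean space of dimension `d`. -/
abbrev E (d : ℕ) : Type := EuclideanSpace ℝ (Fin d)

/-- The closed `d`-simplex spanned by the (affinely independent) vertices of `T`. -/
def body {d : ℕ} (T : Affine.Simplex ℝ (E d) d) : Set (E d) :=
  convexHull ℝ (range T.points)

/-- The closed facet of the simplex `T` opposite to its `i`-th vertex. -/
def facet {d : ℕ} (T : Affine.Simplex ℝ (E d) d) (i : Fin (d + 1)) : Set (E d) :=
  convexHull ℝ (T.points '' {i}ᶜ)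

/-- The `(d-1)`-dimensional Hausdorff measure on `ℝ^d`, normalized so that it is the
`(d-1)`-dimensional Lebesgue measure on hyperplanes. -/
def area (d : ℕ) : Measure (E d) := Measure.euclideanHausdorffMeasure (d - 1)

/-- The surface measure on the boundary of `K`. -/
def surface {d : ℕ} (K : Set (E d)) : Measure (E d) := (area d).restrict (frontier K)

/-- `𝔗` is a partition of the polytopic element `K` into non-overlapping `d`-simplices which
satisfies the mesh regularity condition with constant `γ`. -/
structure IsRegularPartition {d : ℕ} (γ : ℝ) (K : Set (E d))
    (𝔗 : Finset (Affine.Simplex ℝ (E d) d)) : Prop where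
  /-- The simplices cover `K` exactly. -/
  iUnion_eq : ⋃ T ∈ 𝔗, body T = K
  /-- Distinct simplices do not overlap. -/
  disjoint : ∀ T ∈ 𝔗, ∀ T' ∈ 𝔗, T ≠ T' → Disjoint (interior (body T)) (interior (body T'))
  /-- Up to null sets, `∂T ∩ ∂K` consists of entire facets of `T`. -/
  facets : ∀ T ∈ 𝔗, ∀ i, facet T i ⊆ frontier K ∨ area d (facet T i ∩ frontier K) = 0
  /-- `γ h_K ≤ d |T| |F|⁻¹` with `F = ∂T ∩ ∂K` (the right-hand side is `∞` when `|F| = 0`). -/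
  regular : ∀ T ∈ 𝔗, (frontier (body T) ∩ frontier K).Nonempty →
    ENNReal.ofReal (γ * Metric.diam K) ≤
      d * volume (body T) * (area d (frontier (body T) ∩ frontier K))⁻¹

/-- `K` is a polytopic mesh element satisfying the regularity assumptions with constant `γ`. -/
def IsRegularElement {d : ℕ} (γ : ℝ) (K : Set (E d)) : Prop :=
  ∃ 𝔗 : Finset (Affine.Simplex ℝ (E d) d), IsRegularPartition γ K 𝔗

/-- `g` is the distributional gradient of `v` in the interior of `K`: integration by parts holds
against all smooth functions with compact support in the interior of `K`, in all directions. -/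
def IsWeakGradient {d : ℕ} (K : Set (E d)) (v : E d → ℝ) (g : E d → E d) : Prop :=
  ∀ φ : E d → ℝ, ContDiff ℝ ∞ φ → HasCompactSupport φ → tsupport φ ⊆ interior K →
    ∀ e : E d, ∫ x in interior K, v x * fderiv ℝ φ x e = - ∫ x in interior K, inner ℝ (g x) e * φ x

/-- `v ∈ W^{1,q}(K)` with distributional gradient `∇v = g`. -/
structure MemSobolev {d : ℕ} (q : ℝ) (K : Set (E d)) (v : E d → ℝ) (g : E d → E d) : Prop where
  memLp : MemLp v (ENNReal.ofReal q) (volume.restrict K)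
  memLp_grad : MemLp g (ENNReal.ofReal q) (volume.restrict K)
  weakGradient : IsWeakGradient K v g

/-- `w` is the trace of `v` on `∂K`: for almost every `x ∈ ∂K`, the averages of `|v - w(x)|` over
`K ∩ B(x, r)` tend to `0` as `r → 0⁺`. This determines `w` almost everywhere on `∂K` and depends
only on the almost everywhere class of `v`. -/
def IsTrace {d : ℕ} (K : Set (E d)) (v w : E d → ℝ) : Prop :=
  ∀ᵐ x ∂(surface K),
    Tendsto (fun r : ℝ => ⨍ y in K ∩ Metric.ball x r, |v y - w x|) (𝓝[>] 0) (𝓝 0)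

/-- The trace acts as the restriction to `∂K` on functions that are continuous on `K`. -/
theorem isTrace_self_of_continuousOn {d : ℕ} {K : Set (E d)} (hK : IsClosed K) {v : E d → ℝ}
    (hv : ContinuousOn v K) : IsTrace K v v := by
  unfold IsTrace surface
  rw [ae_restrict_iff' isClosed_frontier.measurableSet]
  refine Eventually.of_forall fun x hx => ?_
  have hxK : x ∈ K := hK.frontier_subset hx
  rw [Metric.tendsto_nhds]
  intro ε hε
  obtain ⟨δ, hδ, h⟩ := Metric.continuousWithinAt_iff.1 (hv x hxK) (ε / 2) (half_pos hε)
  filter_upwards [Ioo_mem_nhdsGT hδ] with r hr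
  have hm : MeasurableSet (K ∩ Metric.ball x r) := hK.measurableSet.inter measurableSet_ball
  have hb : ∀ y ∈ K ∩ Metric.ball x r, ‖|v y - v x|‖ ≤ ε / 2 := by
    intro y hy
    have := h hy.1 ((Metric.mem_ball.1 hy.2).trans hr.2)
    rw [Real.dist_eq] at this
    simpa using this.le
  have hfin : volume (K ∩ Metric.ball x r) ≠ ⊤ :=
    ((measure_mono inter_subset_right).trans_lt measure_ball_lt_top).ne
  have hint := norm_setIntegral_le_of_norm_le_const hfin.lt_top hb
  rw [dist_zero_right, setAverage_eq, norm_smul, norm_inv, Real.norm_of_nonneg measureReal_nonneg]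
  rcases eq_or_lt_of_le (measureReal_nonneg (μ := volume) (s := K ∩ Metric.ball x r)) with h0 | h0
  · rw [← h0]; simpa using hε
  · rw [inv_mul_lt_iff₀ h0]
    nlinarith

/-- The constant `C_tr(q, s, d, γ)`. -/
def traceConst (q s : ℝ) (d : ℕ) (γ : ℝ) : ℝ :=
  (d * Real.pi ^ (d * (s - q) / (2 * s)) / (γ * Real.Gamma (d / 2 + 1) ^ ((s - q) / s))
    + (q - 1) / γ) ^ (1 / q)

/-- `q* = qd / (d - q)`, used for `q < d`. -/
def qStar (q : ℝ) (d : ℕ) : ℝ := q * d / (d - q)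

/-- `q♯ = q(d - 1) / (d - q)`, used for `q < d`. -/
def qSharp (q : ℝ) (d : ℕ) : ℝ := q * (d - 1) / (d - q)

end SobolevTrace

end

/-!
The trace is built facet by facet, in conical coordinates. Let `F` be a facet of a simplex `T` of
the partition, `a` the opposite vertex, and write the points of `T` as `a + t (y - a)` with
`0 < t < 1` and `y ∈ F`. Testing the weak gradient against `t⁻ᵈ θ(t) η(y) (x - a)`
(`IsWeakGradient.integral_cone`) shows that `t ↦ v (a + t (y - a))` has the weak derivative
`⟪g, y - a⟫`; hence for almost every `y` it is absolutely continuous on `[δ, 1]` for all `δ > 0`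
and has an end value `w y` at `t = 1` (`exists_ae_eq_sub_integral`, `exists_coneTrace`).

Integrating the derivative of `tᵈ |v|ᵖ` over `(0, 1)` bounds `|w y|ᵖ` by
`∫ tᵈ⁻¹ (d |v|ᵖ + p |v|ᵖ⁻¹ |∂ₜ v|) dt` (`ofReal_rpow_le_lintegral`). As `tᵈ⁻¹ dt dy` is a multiple
of Lebesgue measure, with the same factor as in `d |T| = c |F|`, integration over `F` gives
`d |T| ∫_F |w|ᵖ ≤ |F| ∫_T (d |v|ᵖ + p |v|ᵖ⁻¹ h |∇v|)` (`exists_facetTrace`). The regularity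
condition is exactly what is needed to sum over all boundary facets:
`γ h ∫_∂K |w|ᵖ ≤ ∫_K (d |v|ᵖ + p |v|ᵖ⁻¹ h |∇v|)` for every `p ≥ 1`
(`IsRegularPartition.exists_trace`).

The function `w` is the trace: near `y` the difference `|v (a + t (y' - a)) - w y|` is at most
`|w y' - w y|` plus the integral of `h |∇v|` over the end of the ray through `y'`, and both average
to zero by Lebesgue differentiation on the base (`ae_tendsto_lintegral_coneSet`). It matters here
that almost every boundary point of `K` lies on a single simplex: two nonoverlapping simplices
having the point in the relative interiors of their facets would fill a neighbourhood of it
(`IsRegularPartition.eq_of_mem_openFacet`).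

Both inequalities then follow from the estimate with `p = q` and `p = q♯`, by Hölder's inequality
(`q♯ - 1 = q* (1 - 1 / q)`) and Young's inequality (`mul_rpow_add_le`); for `p = q♯` the `Lᵖ` norm
of `v` is controlled by its `L^{q*}` norm and by the bound `|K| ≤ ω_d h ^ d`, which is where the
factor with `π` and `Γ` in the constant comes from.
-/

open scoped NNReal

namespace SobolevTrace

/-! ### Test functions and the fundamental lemma on products -/

section

/-- `φ` is a smooth test function on `F` whose support is a compact subset of `U`; here `F` is `ℝ`
or a Euclidean space. -/
structure IsTest {F : Type*} [NormedAddCommGroup F] [NormedSpace ℝ F] (U : Set F) (φ : F → ℝ) :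
    Prop where
  contDiff : ContDiff ℝ ∞ φ
  compact : HasCompactSupport φ
  subset : tsupport φ ⊆ U

namespace IsTest

variable {F : Type*} [NormedAddCommGroup F] [NormedSpace ℝ F] {U U' : Set F} {φ ψ : F → ℝ}

theorem mono (h : IsTest U φ) (hU : U ⊆ U') : IsTest U' φ :=
  ⟨h.contDiff, h.compact, h.subset.trans hU⟩

theorem continuous (h : IsTest U φ) : Continuous φ := h.contDiff.continuous

theorem exists_bound (h : IsTest U φ) : ∃ C, ∀ x, ‖φ x‖ ≤ C :=
  h.compact.exists_bound_of_continuous h.continuous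

theorem eq_zero (h : IsTest U φ) {x : F} (hx : x ∉ U) : φ x = 0 :=
  image_eq_zero_of_notMem_tsupport fun h' => hx (h.subset h')

theorem deriv {U : Set ℝ} {θ : ℝ → ℝ} (h : IsTest U θ) : IsTest U (deriv θ) :=
  ⟨(contDiff_infty_iff_deriv.1 h.contDiff).2, h.compact.deriv,
    (closure_mono support_deriv_subset).trans ((isClosed_tsupport θ).closure_eq.subset.trans
      h.subset)⟩

theorem hasDerivAt {U : Set ℝ} {θ : ℝ → ℝ} (h : IsTest U θ) (t : ℝ) :
    HasDerivAt θ (_root_.deriv θ t) t :=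
  ((contDiff_infty_iff_deriv.1 h.contDiff).1 t).hasDerivAt

theorem sub_const_mul (h : IsTest U φ) (h' : IsTest U ψ) (c : ℝ) :
    IsTest U (fun x => φ x - c * ψ x) := by
  have hc : HasCompactSupport (fun x => c * ψ x) := h'.compact.mul_left
  refine ⟨h.contDiff.sub (contDiff_const.mul h'.contDiff), h.compact.sub hc, ?_⟩
  have h1 : tsupport (fun x => c * ψ x) ⊆ tsupport ψ := tsupport_mul_subset_right
  exact (tsupport_sub φ (fun x => c * ψ x)).trans
    (union_subset h.subset (h1.trans h'.subset))

/-- A test function on an interval with vanishing integral has a primitive which is a test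
function. -/
theorem exists_primitive {a b : ℝ} (hab : a < b) {θ : ℝ → ℝ} (h : IsTest (Ioo a b) θ)
    (h0 : ∫ t, θ t = 0) : ∃ χ, IsTest (Ioo a b) χ ∧ _root_.deriv χ = θ := by
  have hK : IsCompact (tsupport θ) := h.compact
  -- a compact subset of `(a, b)` lies in some `[a', b']` with `a < a'` and `b' < b`
  obtain ⟨a', b', ha, hb, hsub⟩ : ∃ a' b', a < a' ∧ b' < b ∧ tsupport θ ⊆ Icc a' b' := by
    rcases (tsupport θ).eq_empty_or_nonempty with he | hne
    · exact ⟨b, a, hab, hab, by simp [he]⟩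
    · exact ⟨sInf (tsupport θ), sSup (tsupport θ), (h.subset (hK.sInf_mem hne)).1,
        (h.subset (hK.sSup_mem hne)).2,
        fun x hx => ⟨csInf_le hK.bddBelow hx, le_csSup hK.bddAbove hx⟩⟩
  have hz : ∀ t, t ∉ Icc a' b' → θ t = 0 := fun t ht =>
    image_eq_zero_of_notMem_tsupport fun h' => ht (hsub h')
  have hderiv : ∀ t, HasDerivAt (fun t => ∫ s in a..t, θ s) (θ t) t := fun t =>
    intervalIntegral.integral_hasDerivAt_right (h.continuous.intervalIntegrable _ _)
      (h.continuous.stronglyMeasurableAtFilter _ _) h.continuous.continuousAt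
  have hd : _root_.deriv (fun t => ∫ s in a..t, θ s) = θ := funext fun t => (hderiv t).deriv
  have hint : Integrable θ := h.continuous.integrable_of_hasCompactSupport h.compact
  have hsupp : Function.support (fun t => ∫ s in a..t, θ s) ⊆ Icc a' b' := by
    intro t ht
    by_contra hn
    apply ht
    rw [mem_Icc, not_and_or, not_le, not_le] at hn
    change ∫ s in a..t, θ s = 0
    rcases hn with hn | hn
    · rw [intervalIntegral.integral_congr (g := fun _ => 0)]
      · simp
      · intro s hs
        refine hz s fun hs' => ?_
        rcases le_total a t with h1 | h1
        · rw [uIcc_of_le h1] at hs; exact absurd hs'.1 (by linarith [hs.2])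
        · rw [uIcc_of_ge h1] at hs; exact absurd hs'.1 (by linarith [hs.2])
    · rcases le_or_gt a t with h1 | h1
      · rw [intervalIntegral.integral_of_le h1, setIntegral_eq_integral_of_forall_compl_eq_zero, h0]
        intro s hs
        refine hz s fun hs' => hs ⟨by linarith [hs'.1], by linarith [hs'.2]⟩
      · rw [intervalIntegral.integral_congr (g := fun _ => 0)]
        · simp
        · intro s hs
          refine hz s fun hs' => ?_
          rw [uIcc_of_ge h1.le] at hs
          exact absurd hs'.1 (by linarith [hs.1, hs'.2])
  have htsupp : tsupport (fun t => ∫ s in a..t, θ s) ⊆ Icc a' b' :=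
    closure_minimal hsupp isClosed_Icc
  refine ⟨fun t => ∫ s in a..t, θ s, ⟨?_, ?_, ?_⟩, hd⟩
  · rw [contDiff_infty_iff_deriv, hd]
    exact ⟨fun t => (hderiv t).differentiableAt, h.contDiff⟩
  · exact HasCompactSupport.intro isCompact_Icc fun x hx => by
      by_contra hne; exact hx (hsupp hne)
  · exact htsupp.trans (fun x hx => ⟨ha.trans_le hx.1, hx.2.trans_lt hb⟩)

theorem exists_integral_eq_one {a b : ℝ} (hab : a < b) :
    ∃ θ : ℝ → ℝ, IsTest (Ioo a b) θ ∧ ∫ t, θ t = 1 := by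
  let f : ContDiffBump ((a + b) / 2) := ⟨(b - a) / 8, (b - a) / 4, by linarith, by linarith⟩
  refine ⟨f.normed volume, ⟨f.contDiff_normed, f.hasCompactSupport_normed, ?_⟩,
    f.integral_normed⟩
  rw [f.tsupport_normed_eq, Real.closedBall_eq_Icc]
  intro x hx
  have h1 : (a + b) / 2 - (b - a) / 4 ≤ x := hx.1
  have h2 : x ≤ (a + b) / 2 + (b - a) / 4 := hx.2
  constructor <;> linarith

end IsTest

variable {n : ℕ}

/-- An integrable function on a product all of whose integrals over measurable rectangles vanish
is zero almost everywhere. -/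
theorem ae_eq_zero_of_forall_setIntegral_prod_eq_zero {α β : Type*} [MeasurableSpace α]
    [MeasurableSpace β] {μ : Measure (α × β)} {H : α × β → ℝ} (hH : Integrable H μ)
    (h : ∀ A B, MeasurableSet A → MeasurableSet B → ∫ z in A ×ˢ B, H z ∂μ = 0) :
    H =ᵐ[μ] 0 := by
  refine hH.ae_eq_zero_of_forall_setIntegral_eq_zero fun s hs _ => ?_
  refine MeasurableSpace.induction_on_inter (C := fun s _ => ∫ z in s, H z ∂μ = 0)
    generateFrom_prod.symm isPiSystem_prod (by simp) ?_ ?_ ?_ s hs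
  · rintro - ⟨s, hs, t, ht, rfl⟩
    exact h s t hs ht
  · intro t ht h1
    have h2 := h univ univ .univ .univ
    rw [univ_prod_univ, setIntegral_univ] at h2
    rw [setIntegral_compl ht hH, h1, h2, sub_zero]
  · intro f hd hf h1
    rw [integral_iUnion hf hd hH.integrableOn]
    simp [h1]

/-- The fundamental lemma of the calculus of variations on a product of open sets, with test
functions of the form `θ(t) η(y)`. -/
theorem ae_eq_zero_of_integral_mul_test_eq_zero {U : Set ℝ} (hU : IsOpen U) {Ω : Set (E n)}
    (hΩ : IsOpen Ω) {H : ℝ × E n → ℝ} (hH : IntegrableOn H (U ×ˢ Ω))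
    (h : ∀ θ η, IsTest U θ → IsTest Ω η → ∫ z in U ×ˢ Ω, H z * (θ z.1 * η z.2) = 0) :
    ∀ᵐ z ∂(volume.restrict (U ×ˢ Ω)), H z = 0 := by
  have hprod : (volume : Measure (ℝ × E n)).restrict (U ×ˢ Ω)
      = (volume.restrict U).prod (volume.restrict Ω) := (Measure.prod_restrict U Ω).symm
  rw [IntegrableOn, hprod] at hH
  simp only [hprod] at h ⊢
  have key : ∀ θ, IsTest U θ → ∀ᵐ y ∂(volume.restrict Ω), ∫ t in U, H (t, y) * θ t = 0 := by
    intro θ hθ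
    obtain ⟨C, hC⟩ := hθ.exists_bound
    have hi : Integrable (fun z : ℝ × E n => H z * θ z.1)
        ((volume.restrict U).prod (volume.restrict Ω)) :=
      hH.mul_bdd (hθ.continuous.comp continuous_fst).aestronglyMeasurable
        (Eventually.of_forall fun z => hC z.1)
    rw [ae_restrict_iff' hΩ.measurableSet]
    refine hΩ.ae_eq_zero_of_integral_contDiff_smul_eq_zero
      (f := fun y => ∫ t in U, H (t, y) * θ t) ?_ ?_
    · exact (IntegrableOn.locallyIntegrableOn hi.integral_prod_right)
    · intro η h1 h2 h3
      have hη : IsTest Ω η := ⟨h1, h2, h3⟩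
      obtain ⟨C', hC'⟩ := hη.exists_bound
      rw [← h θ η hθ hη, integral_prod_symm, ← setIntegral_eq_integral_of_forall_compl_eq_zero
        (s := Ω)]
      · refine integral_congr_ae (Eventually.of_forall fun y => ?_)
        simp only [smul_eq_mul]
        rw [← integral_const_mul]
        congr 1; ext t; ring
      · intro y hy
        simp [hη.eq_zero hy]
      · have := hi.mul_bdd (g := fun z : ℝ × E n => η z.2) (c := C')
          (hη.continuous.comp continuous_snd).aestronglyMeasurable
          (Eventually.of_forall fun z => hC' z.2)
        simpa only [mul_assoc] using this
  refine ae_eq_zero_of_forall_setIntegral_prod_eq_zero hH fun A B hA hB => ?_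
  have hAB : Integrable H (((volume.restrict U).restrict A).prod ((volume.restrict Ω).restrict B)) := by
    rw [Measure.prod_restrict]; exact hH.integrableOn
  have hB' : Integrable H ((volume.restrict U).prod ((volume.restrict Ω).restrict B)) := by
    have : Integrable H (((volume.restrict U).restrict univ).prod
      ((volume.restrict Ω).restrict B)) := by
        rw [Measure.prod_restrict]; exact hH.integrableOn
    simpa using this
  rw [← Measure.prod_restrict, integral_prod _ hAB]
  refine integral_eq_zero_of_ae (ae_restrict_of_ae ?_)
  change ∀ᵐ t ∂(volume.restrict U), ∫ y, H (t, y) ∂((volume.restrict Ω).restrict B) = 0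
  rw [ae_restrict_iff' hU.measurableSet]
  refine hU.ae_eq_zero_of_integral_contDiff_smul_eq_zero
    (f := fun t => ∫ y, H (t, y) ∂((volume.restrict Ω).restrict B)) ?_ ?_
  · exact (IntegrableOn.locallyIntegrableOn hB'.integral_prod_left)
  · intro θ h1 h2 h3
    have hθ : IsTest U θ := ⟨h1, h2, h3⟩
    obtain ⟨C, hC⟩ := hθ.exists_bound
    have hi : Integrable (fun z : ℝ × E n => H z * θ z.1)
        ((volume.restrict U).prod ((volume.restrict Ω).restrict B)) :=
      hB'.mul_bdd (hθ.continuous.comp continuous_fst).aestronglyMeasurable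
        (Eventually.of_forall fun z => hC z.1)
    have h4 : ∫ z, H z * θ z.1 ∂((volume.restrict U).prod ((volume.restrict Ω).restrict B)) = 0 := by
      rw [integral_prod_symm _ hi]
      exact integral_eq_zero_of_ae (ae_restrict_of_ae (key θ hθ))
    rw [← h4, integral_prod _ hi, ← setIntegral_eq_integral_of_forall_compl_eq_zero (s := U)]
    · refine integral_congr_ae (Eventually.of_forall fun t => ?_)
      simp only [smul_eq_mul]
      rw [mul_comm, ← integral_mul_const]
    · intro t ht
      simp [hθ.eq_zero ht]

end

/-! ### Absolute continuity along the first variable -/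

section

variable {n : ℕ}

theorem intervalIntegrable_of_integrableOn_Ioo {G : ℝ → ℝ} {a b : ℝ} (hab : a ≤ b)
    (hG : IntegrableOn G (Ioo a b)) : IntervalIntegrable G volume a b :=
  (intervalIntegrable_iff_integrableOn_Ioo_of_le hab).2 hG

theorem absolutelyContinuousOnInterval_integral_right {G : ℝ → ℝ} {a b : ℝ} (hab : a ≤ b)
    (hG : IntegrableOn G (Ioo a b)) :
    AbsolutelyContinuousOnInterval (fun t => ∫ s in t..b, G s) a b := by
  have h := (intervalIntegrable_of_integrableOn_Ioo hab
    hG).absolutelyContinuousOnInterval_intervalIntegral (c := b) right_mem_uIcc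
  have he : (fun t => ∫ s in t..b, G s) = fun t => -∫ s in b..t, G s :=
    funext fun t => intervalIntegral.integral_symm b t
  rw [he]
  exact h.neg

theorem ae_hasDerivAt_integral_right {G : ℝ → ℝ} {a b : ℝ} (hab : a ≤ b)
    (hG : IntegrableOn G (Ioo a b)) :
    ∀ᵐ t, t ∈ Ioo a b → HasDerivAt (fun t => ∫ s in t..b, G s) (-G t) t := by
  filter_upwards [(intervalIntegrable_of_integrableOn_Ioo hab hG).ae_hasDerivAt_integral]
    with t ht htI
  have := (ht (by rw [uIcc_of_le hab]; exact Ioo_subset_Icc_self htI) b right_mem_uIcc).neg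
  refine this.congr_of_eventuallyEq (Eventually.of_forall fun s => ?_)
  simp [intervalIntegral.integral_symm s b]

/-- Integration by parts against the primitive `∫ s in t..b, G s`. -/
theorem integral_deriv_test_mul_primitive {a b : ℝ} (hab : a < b) {G θ : ℝ → ℝ}
    (hG : IntegrableOn G (Ioo a b)) (hθ : IsTest (Ioo a b) θ) :
    ∫ t in Ioo a b, deriv θ t * ∫ s in t..b, G s = ∫ t in Ioo a b, θ t * G t := by
  have hP := absolutelyContinuousOnInterval_integral_right hab.le hG
  have hθ' : AbsolutelyContinuousOnInterval θ a b :=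
    (hθ.contDiff.of_le (by simp)).contDiffOn.absolutelyContinuousOnInterval
  have h := hθ'.integral_mul_deriv_eq_deriv_mul hP
  rw [hθ.eq_zero (x := a) (by simp), hθ.eq_zero (x := b) (by simp)] at h
  simp only [intervalIntegral.integral_of_le hab.le, ← integral_Ioc_eq_integral_Ioo,
    zero_mul, sub_zero, zero_sub] at h ⊢
  rw [eq_neg_iff_add_eq_zero, add_comm, ← eq_neg_iff_add_eq_zero] at h
  rw [h, ← integral_neg, integral_Ioc_eq_integral_Ioo, integral_Ioc_eq_integral_Ioo]
  refine setIntegral_congr_ae measurableSet_Ioo ?_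
  filter_upwards [ae_hasDerivAt_integral_right hab.le hG] with t ht htI
  rw [(ht htI).deriv]; ring

/-- **Absolute continuity on lines**: a function `V` on `(0, 1) × Ω` whose weak derivative in the
first variable is `G` coincides, on almost every segment `(0, 1) × {y}`, with
`t ↦ w y - ∫ s in t..1, G (s, y)`. Integrability is only required away from `t = 0`. -/
theorem exists_ae_eq_sub_integral {Ω : Set (E n)} (hΩ : IsOpen Ω) {V G : ℝ × E n → ℝ}
    (hVm : Measurable V) (hGm : Measurable G)
    (hV : ∀ δ ∈ Ioo (0 : ℝ) 1, IntegrableOn V (Ioo δ 1 ×ˢ Ω))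
    (hG : ∀ δ ∈ Ioo (0 : ℝ) 1, IntegrableOn G (Ioo δ 1 ×ˢ Ω))
    (hweak : ∀ θ η, IsTest (Ioo 0 1) θ → IsTest Ω η →
      ∫ z in Ioo 0 1 ×ˢ Ω, (V z * deriv θ z.1 + G z * θ z.1) * η z.2 = 0) :
    ∃ w : E n → ℝ, Measurable w ∧ ∀ᵐ y ∂(volume.restrict Ω),
      (∀ δ ∈ Ioo (0 : ℝ) 1, IntegrableOn (fun s => G (s, y)) (Ioo δ 1)) ∧
      ∀ᵐ t ∂(volume.restrict (Ioo 0 1)), V (t, y) = w y - ∫ s in t..1, G (s, y) := by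
  -- `W` is `V` plus the primitive of `G`; the weak equation says that `∂ₜ W = 0`
  set S : Set ((ℝ × E n) × ℝ) := {p | p.1.1 < p.2 ∧ p.2 < 1} with hS
  have hSm : MeasurableSet S :=
    (measurableSet_lt measurable_fst.fst measurable_snd).inter
      (measurableSet_lt measurable_snd measurable_const)
  set I : ℝ × E n → ℝ := fun z => ∫ s, S.indicator (fun p => G (p.2, p.1.2)) (z, s) with hI
  have hIm : Measurable I := by
    refine StronglyMeasurable.measurable (StronglyMeasurable.integral_prod_right'
      (f := S.indicator (fun p => G (p.2, p.1.2))) ?_)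
    exact ((hGm.comp (measurable_snd.prodMk measurable_fst.snd)).indicator
      hSm).stronglyMeasurable
  have hI1 : ∀ t y, I (t, y) = ∫ s in Ioo t 1, G (s, y) := by
    intro t y
    rw [← integral_indicator measurableSet_Ioo]
    rfl
  have hI2 : ∀ t y, t ≤ 1 → I (t, y) = ∫ s in t..1, G (s, y) := by
    intro t y ht
    rw [hI1, intervalIntegral.integral_of_le ht, integral_Ioc_eq_integral_Ioo]
  set W : ℝ × E n → ℝ := fun z => V z + I z with hW
  have hWm : Measurable W := hVm.add hIm
  have hpr : ∀ δ : ℝ, (volume : Measure (ℝ × E n)).restrict (Ioo δ 1 ×ˢ Ω)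
      = (volume.restrict (Ioo δ 1)).prod (volume.restrict Ω) := fun δ =>
    (Measure.prod_restrict _ _).symm
  have hGy : ∀ δ ∈ Ioo (0 : ℝ) 1, ∀ᵐ y ∂(volume.restrict Ω),
      IntegrableOn (fun s => G (s, y)) (Ioo δ 1) := by
    intro δ hδ
    have := hG δ hδ
    rw [IntegrableOn, hpr] at this
    exact this.prod_left_ae
  have hIint : ∀ δ ∈ Ioo (0 : ℝ) 1, IntegrableOn I (Ioo δ 1 ×ˢ Ω) := by
    intro δ hδ
    have h1 := hG δ hδ
    rw [IntegrableOn, hpr] at h1 ⊢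
    have h2 : Integrable (fun z : ℝ × E n => ∫ s in Ioo δ 1, ‖G (s, z.2)‖)
        ((volume.restrict (Ioo δ 1)).prod (volume.restrict Ω)) :=
      (h1.norm.integral_prod_right).comp_snd _
    refine h2.mono' hIm.aestronglyMeasurable ?_
    have h3 : ∀ᵐ z ∂((volume.restrict (Ioo δ 1)).prod (volume.restrict Ω)),
        IntegrableOn (fun s => G (s, z.2)) (Ioo δ 1) :=
      Measure.quasiMeasurePreserving_snd.ae (hGy δ hδ)
    have h4 : ∀ᵐ z ∂((volume.restrict (Ioo δ 1)).prod (volume.restrict Ω)), z.1 ∈ Ioo δ 1 :=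
      Measure.quasiMeasurePreserving_fst.ae (ae_restrict_mem measurableSet_Ioo)
    filter_upwards [h3, h4] with z hz3 hz4
    obtain ⟨t, y⟩ := z
    rw [hI1]
    refine (norm_integral_le_integral_norm _).trans ?_
    exact setIntegral_mono_set hz3.norm (Eventually.of_forall fun _ => norm_nonneg _)
      (Ioo_subset_Ioo_left hz4.1.le).eventuallyLE
  have hWint : ∀ δ ∈ Ioo (0 : ℝ) 1, Integrable W
      ((volume.restrict (Ioo δ 1)).prod (volume.restrict Ω)) := by
    intro δ hδ
    rw [← hpr]
    exact (hV δ hδ).add (hIint δ hδ)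
  have hmul : ∀ δ, ∀ {θ η}, IsTest (Ioo δ 1) θ → IsTest Ω η → ∀ {f : ℝ × E n → ℝ},
      Integrable f ((volume.restrict (Ioo δ 1)).prod (volume.restrict Ω)) →
      Integrable (fun z => f z * (θ z.1 * η z.2))
        ((volume.restrict (Ioo δ 1)).prod (volume.restrict Ω)) := by
    intro δ θ η hθ hη f hf
    obtain ⟨C, hC⟩ := hθ.exists_bound
    obtain ⟨C', hC'⟩ := hη.exists_bound
    refine hf.mul_bdd (c := C * C') ((hθ.continuous.comp continuous_fst).mul
      (hη.continuous.comp continuous_snd)).aestronglyMeasurable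
      (Eventually.of_forall fun z => ?_)
    rw [norm_mul]
    exact mul_le_mul (hC _) (hC' _) (norm_nonneg _) ((norm_nonneg _).trans (hC z.1))
  have hWweak : ∀ δ ∈ Ioo (0 : ℝ) 1, ∀ θ η, IsTest (Ioo δ 1) θ → IsTest Ω η →
      ∫ z, W z * (deriv θ z.1 * η z.2)
        ∂((volume.restrict (Ioo δ 1)).prod (volume.restrict Ω)) = 0 := by
    intro δ hδ θ η hθ hη
    have hVi : Integrable V ((volume.restrict (Ioo δ 1)).prod (volume.restrict Ω)) := by
      rw [← hpr]; exact hV δ hδ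
    have hGi : Integrable G ((volume.restrict (Ioo δ 1)).prod (volume.restrict Ω)) := by
      rw [← hpr]; exact hG δ hδ
    have hIi : Integrable I ((volume.restrict (Ioo δ 1)).prod (volume.restrict Ω)) := by
      rw [← hpr]; exact hIint δ hδ
    have e1 : ∫ z, I z * (deriv θ z.1 * η z.2)
        ∂((volume.restrict (Ioo δ 1)).prod (volume.restrict Ω))
        = ∫ z, G z * (θ z.1 * η z.2)
        ∂((volume.restrict (Ioo δ 1)).prod (volume.restrict Ω)) := by
      rw [integral_prod_symm _ (hmul δ hθ.deriv hη hIi), integral_prod_symm _ (hmul δ hθ hη hGi)]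
      refine integral_congr_ae ?_
      filter_upwards [hGy δ hδ] with y hy
      have := integral_deriv_test_mul_primitive hδ.2 hy hθ
      calc ∫ t in Ioo δ 1, I (t, y) * (deriv θ t * η y)
          = (∫ t in Ioo δ 1, deriv θ t * ∫ s in t..1, G (s, y)) * η y := by
            rw [← integral_mul_const]
            refine setIntegral_congr_fun measurableSet_Ioo fun t ht => ?_
            rw [hI2 t y ht.2.le]; ring
        _ = ∫ t in Ioo δ 1, G (t, y) * (θ t * η y) := by
            rw [this, ← integral_mul_const]
            congr 1; ext t; ring
    have e2 : ∫ z, W z * (deriv θ z.1 * η z.2)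
        ∂((volume.restrict (Ioo δ 1)).prod (volume.restrict Ω))
        = ∫ z, (V z * deriv θ z.1 + G z * θ z.1) * η z.2
        ∂((volume.restrict (Ioo δ 1)).prod (volume.restrict Ω)) := by
      simp only [hW, add_mul]
      rw [integral_add (hmul δ hθ.deriv hη hVi) (hmul δ hθ.deriv hη hIi), e1,
        ← integral_add (hmul δ hθ.deriv hη hVi) (hmul δ hθ hη hGi)]
      congr 1; ext z; ring
    rw [e2, ← hpr, ← hweak θ η (hθ.mono (Ioo_subset_Ioo_left hδ.1.le)) hη]
    symm
    refine setIntegral_eq_of_subset_of_forall_sdiff_eq_zero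
      (measurableSet_Ioo.prod hΩ.measurableSet)
      (prod_mono_left (Ioo_subset_Ioo_left hδ.1.le)) fun z hz => ?_
    have hz1 : z.1 ∉ Ioo δ 1 := fun h => hz.2 ⟨h, hz.1.2⟩
    rw [hθ.eq_zero hz1, hθ.deriv.eq_zero hz1]; ring
  -- `w` is a weighted mean of `W` in `t`
  obtain ⟨θ₀, hθ₀, hθ₀1⟩ := IsTest.exists_integral_eq_one (a := 1 / 2) (b := 1) (by norm_num)
  set w : E n → ℝ := fun y => ∫ t, W (t, y) * θ₀ t with hw
  have hwm : Measurable w := by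
    refine StronglyMeasurable.measurable (StronglyMeasurable.integral_prod_left'
      (f := fun z : ℝ × E n => W z * θ₀ z.1) ?_)
    exact (hWm.mul (hθ₀.continuous.measurable.comp measurable_fst)).stronglyMeasurable
  have hw' : ∀ δ ≤ (1 / 2 : ℝ), ∀ y, w y = ∫ t in Ioo δ 1, W (t, y) * θ₀ t := by
    intro δ hδ y
    rw [setIntegral_eq_integral_of_forall_compl_eq_zero]
    intro t ht
    rw [(hθ₀.mono (Ioo_subset_Ioo_left hδ)).eq_zero ht, mul_zero]
  have key : ∀ δ ∈ Ioc (0 : ℝ) (1 / 2),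
      ∀ᵐ z ∂(volume.restrict (Ioo δ 1 ×ˢ Ω)), W z - w z.2 = 0 := by
    intro δ hδ
    have hδ1 : δ ∈ Ioo (0 : ℝ) 1 := ⟨hδ.1, hδ.2.trans_lt (by norm_num)⟩
    have hθ₀' : IsTest (Ioo δ 1) θ₀ := hθ₀.mono (Ioo_subset_Ioo_left hδ.2)
    have hwi : Integrable w (volume.restrict Ω) := by
      obtain ⟨C, hC⟩ := hθ₀.exists_bound
      have h1 : Integrable (fun z : ℝ × E n => W z * θ₀ z.1)
          ((volume.restrict (Ioo δ 1)).prod (volume.restrict Ω)) :=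
        (hWint δ hδ1).mul_bdd (hθ₀.continuous.comp continuous_fst).aestronglyMeasurable
          (Eventually.of_forall fun z => hC z.1)
      refine h1.integral_prod_right.congr (Eventually.of_forall fun y => ?_)
      exact (hw' δ hδ.2 y).symm
    have hwi' : Integrable (fun z : ℝ × E n => w z.2)
        ((volume.restrict (Ioo δ 1)).prod (volume.restrict Ω)) := hwi.comp_snd _
    refine ae_eq_zero_of_integral_mul_test_eq_zero isOpen_Ioo hΩ ?_ ?_
    · rw [IntegrableOn, hpr]; exact (hWint δ hδ1).sub hwi'
    · intro θ η hθ hη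
      set c := ∫ t, θ t with hc
      obtain ⟨χ, hχ, hχ'⟩ := (hθ.sub_const_mul hθ₀' c).exists_primitive hδ1.2 (by
        rw [integral_sub (hθ.continuous.integrable_of_hasCompactSupport hθ.compact)
          ((hθ₀.continuous.integrable_of_hasCompactSupport hθ₀.compact).const_mul c),
          integral_const_mul, hθ₀1, mul_one, sub_self])
      have h1 := hWweak δ hδ1 χ η hχ hη
      rw [hχ'] at h1
      have h2 : ∫ z, w z.2 * (θ z.1 * η z.2)
          ∂((volume.restrict (Ioo δ 1)).prod (volume.restrict Ω))
          = ∫ z, W z * ((c * θ₀ z.1) * η z.2)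
          ∂((volume.restrict (Ioo δ 1)).prod (volume.restrict Ω)) := by
        rw [integral_prod_symm _ (hmul δ hθ hη hwi'), integral_prod_symm]
        · congr 1; ext y
          have h3 : ∫ t in Ioo δ 1, θ t = c :=
            setIntegral_eq_integral_of_forall_compl_eq_zero fun t ht => hθ.eq_zero ht
          calc ∫ t in Ioo δ 1, w y * (θ t * η y) = w y * (c * η y) := by
                rw [integral_const_mul, integral_mul_const, h3]
            _ = (∫ t in Ioo δ 1, W (t, y) * θ₀ t) * (c * η y) := by rw [← hw' δ hδ.2]
            _ = _ := by
                rw [← integral_mul_const]; congr 1; ext t; ring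
        · refine ((hmul δ hθ₀' hη (hWint δ hδ1)).const_mul c).congr
            (Eventually.of_forall fun z => ?_)
          simp only; ring
      rw [hpr]
      simp only [sub_mul] at h1 ⊢
      rw [integral_sub (hmul δ hθ hη (hWint δ hδ1)) (hmul δ hθ hη hwi'), h2, ← h1,
        ← integral_sub (hmul δ hθ hη (hWint δ hδ1))]
      · congr 1; ext z; ring
      · refine ((hmul δ hθ₀' hη (hWint δ hδ1)).const_mul c).congr
          (Eventually.of_forall fun z => ?_)
        simp only; ring
  have hk : ∀ k : ℕ, 1 / ((k : ℝ) + 2) ∈ Ioc (0 : ℝ) (1 / 2) := fun k =>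
    ⟨by positivity, one_div_le_one_div_of_le (by norm_num) (by linarith [k.cast_nonneg (α := ℝ)])⟩
  have hk' : ∀ δ > (0 : ℝ), ∃ k : ℕ, 1 / ((k : ℝ) + 2) < δ := fun δ hδ => by
    obtain ⟨k, hk⟩ := exists_nat_one_div_lt hδ
    exact ⟨k, (one_div_le_one_div_of_le (by positivity) (by linarith)).trans_lt hk⟩
  have hall : ∀ᵐ z ∂(volume.restrict (Ioo 0 1 ×ˢ Ω)), W z - w z.2 = 0 := by
    have hU : (Ioo (0 : ℝ) 1 ×ˢ Ω) = ⋃ k : ℕ, Ioo (1 / ((k : ℝ) + 2)) 1 ×ˢ Ω := by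
      ext z
      simp only [mem_prod, mem_iUnion, mem_Ioo]
      constructor
      · rintro ⟨⟨h1, h2⟩, h3⟩
        obtain ⟨k, hk⟩ := hk' _ h1
        exact ⟨k, ⟨hk, h2⟩, h3⟩
      · rintro ⟨k, ⟨h1, h2⟩, h3⟩
        exact ⟨⟨(hk k).1.trans h1, h2⟩, h3⟩
    rw [hU, ae_restrict_iUnion_iff]
    exact fun k => key _ (hk k)
  rw [hpr 0] at hall
  have hswap : ∀ᵐ z ∂((volume.restrict Ω).prod (volume.restrict (Ioo (0 : ℝ) 1))),
      W z.swap - w z.1 = 0 := Measure.measurePreserving_swap.quasiMeasurePreserving.ae hall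
  refine ⟨w, hwm, ?_⟩
  have hGall : ∀ᵐ y ∂(volume.restrict Ω), ∀ k : ℕ,
      IntegrableOn (fun s => G (s, y)) (Ioo (1 / ((k : ℝ) + 2)) 1) :=
    ae_all_iff.2 fun k => hGy _ ⟨(hk k).1, (hk k).2.trans_lt (by norm_num)⟩
  filter_upwards [Measure.ae_ae_of_ae_prod hswap, hGall] with y hy1 hy2
  refine ⟨fun δ hδ => ?_, ?_⟩
  · obtain ⟨k, hk⟩ := hk' δ hδ.1
    exact (hy2 k).mono_set (Ioo_subset_Ioo_left hk.le)
  · filter_upwards [hy1, ae_restrict_mem measurableSet_Ioo] with t ht htI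
    have := hI2 t y htI.2.le
    simp only [Prod.swap_prod_mk, hW] at ht
    linarith

end

/-! ### The weighted one-dimensional trace inequality -/

theorem absolutelyContinuousOnInterval_comp {f : ℝ → ℝ} {g : ℝ → ℝ} {a b : ℝ} {K : ℝ≥0}
    {s : Set ℝ} (hg : LipschitzOnWith K g s) (hf : AbsolutelyContinuousOnInterval f a b)
    (hfs : MapsTo f (uIcc a b) s) : AbsolutelyContinuousOnInterval (fun t => g (f t)) a b := by
  rw [absolutelyContinuousOnInterval_iff] at hf ⊢
  intro ε hε
  obtain ⟨δ, hδ, h⟩ := hf (ε / (K + 1)) (by positivity)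
  refine ⟨δ, hδ, fun E hE hlt => ?_⟩
  have h1 := h E hE hlt
  have h2 : ∑ i ∈ Finset.range E.1, dist (g (f (E.2 i).1)) (g (f (E.2 i).2))
      ≤ ∑ i ∈ Finset.range E.1, K * dist (f (E.2 i).1) (f (E.2 i).2) := by
    refine Finset.sum_le_sum fun i hi => ?_
    exact hg.dist_le_mul _ (hfs (hE.1 i hi).1) _ (hfs (hE.1 i hi).2)
  rw [← Finset.mul_sum] at h2
  rw [lt_div_iff₀ (by positivity)] at h1
  have h3 : 0 ≤ ∑ i ∈ Finset.range E.1, dist (f (E.2 i).1) (f (E.2 i).2) :=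
    Finset.sum_nonneg fun _ _ => dist_nonneg
  nlinarith [K.coe_nonneg]

theorem lipschitzOnWith_rpow {p : ℝ} (hp : 1 ≤ p) (M : ℝ) :
    ∃ K : ℝ≥0, LipschitzOnWith K (fun x : ℝ => x ^ p) (Icc 0 M) := by
  have hM : 0 ≤ p * |M| ^ (p - 1) := by positivity
  refine ⟨(p * |M| ^ (p - 1)).toNNReal, ?_⟩
  refine Convex.lipschitzOnWith_of_nnnorm_hasDerivWithin_le (convex_Icc 0 M)
    (f' := fun x => p * x ^ (p - 1))
    (fun x _ => (Real.hasDerivAt_rpow_const (Or.inr hp)).hasDerivWithinAt) fun x hx => ?_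
  rw [← NNReal.coe_le_coe, coe_nnnorm, Real.coe_toNNReal _ hM, Real.norm_of_nonneg
    (mul_nonneg (by linarith) (Real.rpow_nonneg hx.1 _))]
  have h1 : 0 ≤ p - 1 := by linarith
  have h2 : x ≤ |M| := hx.2.trans (le_abs_self M)
  have h3 := Real.rpow_le_rpow hx.1 h2 h1
  exact mul_le_mul_of_nonneg_left h3 (by linarith)

theorem abs_le_of_hasDerivAt_abs {U : ℝ → ℝ} {u m t : ℝ} (hU : HasDerivAt U u t)
    (hm : HasDerivAt (fun t => |U t|) m t) : |m| ≤ |u| := by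
  by_cases h0 : U t = 0
  · have hmin : IsLocalMin (fun t => |U t|) t :=
      Eventually.of_forall fun s => by simp [h0]
    rw [hmin.hasDerivAt_eq_zero hm, abs_zero]
    exact abs_nonneg u
  · have := hm.unique ((hasDerivAt_abs h0).comp t hU)
    rw [this, abs_mul]
    rcases lt_or_gt_of_ne h0 with h | h <;> simp [h]

/-- The one-dimensional trace inequality with the weight `t ^ n`: for `V` with derivative `G` on
`(0, 1)` and end value `w`, `|w| ^ p` is bounded by the integral of
`(t ^ (n + 1) |V| ^ p)'`. -/
theorem ofReal_rpow_le_lintegral (n : ℕ) {w p : ℝ} (hp : 1 ≤ p) {V G : ℝ → ℝ}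
    (hG : ∀ δ ∈ Ioo (0 : ℝ) 1, IntegrableOn G (Ioo δ 1))
    (hV : ∀ᵐ t ∂(volume.restrict (Ioo (0 : ℝ) 1)), V t = w - ∫ s in t..1, G s) :
    ENNReal.ofReal (|w| ^ p) ≤ ∫⁻ t in Ioo (0 : ℝ) 1,
      ENNReal.ofReal (t ^ n * ((n + 1) * |V t| ^ p + p * |V t| ^ (p - 1) * |G t|)) := by
  set R := ∫⁻ t in Ioo (0 : ℝ) 1,
      ENNReal.ofReal (t ^ n * ((n + 1) * |V t| ^ p + p * |V t| ^ (p - 1) * |G t|))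
  -- the weight `t ^ (n + 1) - τ ^ (n + 1)` vanishes at `τ`, so no boundary term appears there
  have key : ∀ τ ∈ Ioo (0 : ℝ) 1, ENNReal.ofReal ((1 - τ ^ (n + 1)) * |w| ^ p) ≤ R := by
    intro τ hτ
    set U : ℝ → ℝ := fun t => w - ∫ s in t..1, G s with hU
    have hPac := absolutelyContinuousOnInterval_integral_right hτ.2.le (hG τ hτ)
    have hUac : AbsolutelyContinuousOnInterval U τ 1 := by
      have hc : AbsolutelyContinuousOnInterval (fun _ : ℝ => w) τ 1 :=
        (contDiff_const.contDiffOn).absolutelyContinuousOnInterval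
      exact hc.sub hPac
    have habs : AbsolutelyContinuousOnInterval (fun t => |U t|) τ 1 :=
      absolutelyContinuousOnInterval_comp (K := 1) (s := univ) (g := fun x => |x|)
        (LipschitzWith.lipschitzOnWith (lipschitzWith_one_norm (E := ℝ))) hUac
        (mapsTo_univ _ _)
    obtain ⟨M, hM⟩ := hUac.exists_bound
    obtain ⟨L, hL⟩ := lipschitzOnWith_rpow hp M
    have hpow : AbsolutelyContinuousOnInterval (fun t => |U t| ^ p) τ 1 :=
      absolutelyContinuousOnInterval_comp (g := fun x => x ^ p) hL habs
        fun t ht => ⟨abs_nonneg _, hM t ht⟩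
    have hwt : AbsolutelyContinuousOnInterval (fun t : ℝ => t ^ (n + 1) - τ ^ (n + 1)) τ 1 :=
      ContDiffOn.absolutelyContinuousOnInterval
        (((contDiff_id.pow (n + 1)).sub contDiff_const).contDiffOn)
    have hFTC := (hwt.mul hpow).integral_deriv_eq_sub
    have hU1 : U 1 = w := by simp [hU]
    simp only [Pi.mul_apply, hU1, sub_self, zero_mul, sub_zero, one_pow] at hFTC
    rw [← hFTC, intervalIntegral.integral_of_le hτ.2.le, integral_Ioc_eq_integral_Ioo]
    refine (ENNReal.ofReal_le_ofReal (le_abs_self _)).trans ?_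
    rw [← Real.norm_eq_abs, ofReal_norm]
    refine (enorm_integral_le_lintegral_enorm _).trans ?_
    refine le_trans (lintegral_mono_ae ?_) (lintegral_mono_set (Ioo_subset_Ioo_left hτ.1.le))
    rw [ae_restrict_iff' measurableSet_Ioo] at hV ⊢
    filter_upwards [hV, ae_hasDerivAt_integral_right hτ.2.le (hG τ hτ), habs.ae_differentiableAt]
      with t h1 h2 h3 ht
    have ht0 : 0 < t := hτ.1.trans ht.1
    have htI : t ∈ uIcc τ 1 := by rw [uIcc_of_le hτ.2.le]; exact Ioo_subset_Icc_self ht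
    have hUd : HasDerivAt U (G t) t := by
      have h4 := (h2 ht).const_sub w
      rwa [neg_neg] at h4
    have hm := (h3 htI).hasDerivAt
    set m := deriv (fun t => |U t|) t
    have hmle : |m| ≤ |G t| := abs_le_of_hasDerivAt_abs hUd hm
    have hd := (((hasDerivAt_pow (n + 1) t).sub_const (τ ^ (n + 1))).mul
      (hm.rpow_const (p := p) (Or.inr hp))).deriv
    have hVU : V t = U t := h1 ⟨ht0, ht.2⟩
    have hd' : deriv ((fun t : ℝ => t ^ (n + 1) - τ ^ (n + 1)) * fun t => |U t| ^ p) t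
      = ((n + 1 : ℕ) : ℝ) * t ^ n * |U t| ^ p
        + (t ^ (n + 1) - τ ^ (n + 1)) * (m * p * |U t| ^ (p - 1)) := hd
    rw [hd', ← ofReal_norm, Real.norm_eq_abs, hVU]
    refine ENNReal.ofReal_le_ofReal ?_
    have hτt : τ ^ (n + 1) ≤ t ^ (n + 1) := pow_le_pow_left₀ hτ.1.le ht.1.le _
    have hτ0 : 0 ≤ τ ^ (n + 1) := pow_nonneg hτ.1.le _
    have htn : t ^ (n + 1) ≤ t ^ n := pow_le_pow_of_le_one ht0.le ht.2.le n.le_succ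
    have hA : 0 ≤ |U t| ^ p := by positivity
    have hB : 0 ≤ |U t| ^ (p - 1) := by positivity
    refine (abs_add_le _ _).trans ?_
    rw [abs_of_nonneg (by positivity : 0 ≤ ((n + 1 : ℕ) : ℝ) * t ^ n * |U t| ^ p), abs_mul,
      abs_of_nonneg (sub_nonneg.2 hτt), abs_mul, abs_mul, abs_of_nonneg hB,
      abs_of_nonneg (by linarith : (0 : ℝ) ≤ p)]
    have h5 : (t ^ (n + 1) - τ ^ (n + 1)) * (|m| * p * |U t| ^ (p - 1))
        ≤ t ^ n * (|G t| * p * |U t| ^ (p - 1)) := by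
      gcongr
      linarith
    push_cast
    linarith
  have hlim : Tendsto (fun τ : ℝ => ENNReal.ofReal ((1 - τ ^ (n + 1)) * |w| ^ p)) (𝓝[>] 0)
      (𝓝 (ENNReal.ofReal (|w| ^ p))) := by
    refine (ENNReal.continuous_ofReal.tendsto _).comp (tendsto_nhdsWithin_of_tendsto_nhds ?_)
    have hc : Continuous fun τ : ℝ => (1 - τ ^ (n + 1)) * |w| ^ p := by fun_prop
    simpa using hc.tendsto 0
  exact le_of_tendsto hlim (by
    filter_upwards [Ioo_mem_nhdsGT (zero_lt_one' ℝ)] with τ hτ using key τ hτ)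

/-! ### Conical coordinates -/

section

variable {n : ℕ}

/-- Conical coordinates with apex `a`: `(t, y)` is sent to the point `a + t (j y - a)` on the ray
from `a` to the point `j y = a + e (1, y)` of a hyperplane not containing `a`. -/
def cone (a : E (n + 1)) (e : (ℝ × E n) ≃L[ℝ] E (n + 1)) (z : ℝ × E n) : E (n + 1) :=
  a + e (z.1, z.1 • z.2)

/-- The open cone with apex `a` over the base `Ω`. -/
def coneSet (a : E (n + 1)) (e : (ℝ × E n) ≃L[ℝ] E (n + 1)) (Ω : Set (E n)) : Set (E (n + 1)) :=
  {x | (e.symm (x - a)).1 ∈ Ioo (0 : ℝ) 1 ∧ (e.symm (x - a)).1⁻¹ • (e.symm (x - a)).2 ∈ Ω}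

/-- The product volume is a Haar measure, so that it can be compared with Lebesgue measure. -/
instance : (volume : Measure (ℝ × E n)).IsAddHaarMeasure := by
  rw [Measure.volume_eq_prod]; infer_instance

/-- The ratio between the Lebesgue measure of `ℝⁿ⁺¹` and the image under `e` of the product
measure. -/
noncomputable def coneFactor (e : (ℝ × E n) ≃L[ℝ] E (n + 1)) : ℝ≥0 :=
  Measure.addHaarScalarFactor (volume : Measure (E (n + 1))) (volume.map e)

variable (a : E (n + 1)) (e : (ℝ × E n) ≃L[ℝ] E (n + 1))

theorem coneFactor_pos : 0 < coneFactor e :=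
  Measure.addHaarScalarFactor_pos_of_isAddHaarMeasure _ _

theorem volume_eq_coneFactor_smul :
    (volume : Measure (E (n + 1))) = coneFactor e • volume.map e :=
  Measure.isAddLeftInvariant_eq_smul _ _

theorem continuous_cone : Continuous (cone a e) := by
  unfold cone; fun_prop

theorem cone_sub (z : ℝ × E n) : cone a e z - a = z.1 • e (1, z.2) := by
  rw [cone, add_sub_cancel_left, ← map_smul]; simp

theorem symm_cone_sub (z : ℝ × E n) : e.symm (cone a e z - a) = (z.1, z.1 • z.2) := by
  simp [cone]

variable {a e}

theorem cone_mem_coneSet {Ω : Set (E n)} {z : ℝ × E n} (h : z ∈ Ioo (0 : ℝ) 1 ×ˢ Ω) :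
    cone a e z ∈ coneSet a e Ω := by
  have h0 : z.1 ≠ 0 := h.1.1.ne'
  simp only [coneSet, mem_ofPred_eq, symm_cone_sub]
  exact ⟨h.1, by rw [smul_smul, inv_mul_cancel₀ h0, one_smul]; exact h.2⟩

theorem exists_cone_eq {Ω : Set (E n)} {x : E (n + 1)} (h : x ∈ coneSet a e Ω) :
    ∃ z ∈ Ioo (0 : ℝ) 1 ×ˢ Ω, cone a e z = x := by
  refine ⟨((e.symm (x - a)).1, (e.symm (x - a)).1⁻¹ • (e.symm (x - a)).2), h, ?_⟩
  have h0 : (e.symm (x - a)).1 ≠ 0 := h.1.1.ne'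
  simp only [cone, smul_smul, mul_inv_cancel₀ h0, one_smul, Prod.mk.eta,
    ContinuousLinearEquiv.apply_symm_apply]
  abel

theorem isOpen_coneSet {Ω : Set (E n)} (hΩ : IsOpen Ω) : IsOpen (coneSet a e Ω) := by
  have hc : Continuous fun x : E (n + 1) => e.symm (x - a) := by fun_prop
  rw [isOpen_iff_mem_nhds]
  intro x hx
  have h1 : ContinuousAt (fun x : E (n + 1) => (e.symm (x - a)).1⁻¹ • (e.symm (x - a)).2) x :=
    (hc.fst.continuousAt.inv₀ hx.1.1.ne').smul hc.snd.continuousAt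
  exact inter_mem (hc.fst.continuousAt (isOpen_Ioo.mem_nhds hx.1)) (h1 (hΩ.mem_nhds hx.2))

variable (a e)

/-- The change of variables formula for conical coordinates. -/
theorem restrict_coneSet_eq_map {Ω : Set (E n)} (hΩ : IsOpen Ω) :
    volume.restrict (coneSet a e Ω) = coneFactor e •
      ((volume.restrict (Ioo (0 : ℝ) 1 ×ˢ Ω)).withDensity
        (fun z => ENNReal.ofReal (z.1 ^ n))).map (cone a e) := by
  have hdm : Measurable fun z : ℝ × E n => ENNReal.ofReal (z.1 ^ n) := by fun_prop
  ext s hs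
  have hC := (isOpen_coneSet (a := a) (e := e) hΩ).measurableSet
  rw [Measure.restrict_apply hs, Measure.smul_apply,
    Measure.map_apply (continuous_cone a e).measurable hs,
    withDensity_apply _ ((continuous_cone a e).measurable hs), Measure.restrict_restrict
      ((continuous_cone a e).measurable hs)]
  have hA : MeasurableSet (e ⁻¹' ((fun x => a + x) ⁻¹' (s ∩ coneSet a e Ω))) :=
    e.continuous.measurable ((measurable_const_add a) (hs.inter hC))
  have h1 : volume (s ∩ coneSet a e Ω)
      = coneFactor e • volume (e ⁻¹' ((fun x => a + x) ⁻¹' (s ∩ coneSet a e Ω))) := by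
    rw [← measure_preimage_add volume a]
    conv_lhs => rw [volume_eq_coneFactor_smul e]
    rw [Measure.smul_apply, Measure.map_apply e.continuous.measurable
      ((measurable_const_add a) (hs.inter hC))]
  rw [h1]
  congr 1
  have hB : MeasurableSet (cone a e ⁻¹' s ∩ Ioo (0 : ℝ) 1 ×ˢ Ω) :=
    ((continuous_cone a e).measurable hs).inter (measurableSet_Ioo.prod hΩ.measurableSet)
  rw [← lintegral_indicator hB, Measure.volume_eq_prod, Measure.prod_apply hA,
    lintegral_prod _ (hdm.indicator hB).aemeasurable]
  refine lintegral_congr fun t => ?_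
  by_cases ht : t ∈ Ioo (0 : ℝ) 1
  · have hset : (Prod.mk t) ⁻¹' (cone a e ⁻¹' s ∩ Ioo (0 : ℝ) 1 ×ˢ Ω)
        = (fun y : E n => t • y) ⁻¹'
          ((Prod.mk t) ⁻¹' (e ⁻¹' ((fun x => a + x) ⁻¹' (s ∩ coneSet a e Ω)))) := by
      ext y
      simp only [mem_preimage, mem_inter_iff, mem_prod, coneSet, mem_ofPred_eq, cone,
        add_sub_cancel_left, ContinuousLinearEquiv.symm_apply_apply, smul_smul,
        inv_mul_cancel₀ ht.1.ne', one_smul]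
    have h2 : ∀ y, (cone a e ⁻¹' s ∩ Ioo (0 : ℝ) 1 ×ˢ Ω).indicator
        (fun z : ℝ × E n => ENNReal.ofReal (z.1 ^ n)) (t, y)
        = ((Prod.mk t) ⁻¹' (cone a e ⁻¹' s ∩ Ioo (0 : ℝ) 1 ×ˢ Ω)).indicator
          (fun _ => ENNReal.ofReal (t ^ n)) y := fun y => rfl
    simp only [h2]
    rw [lintegral_indicator (measurable_prodMk_left hB), setLIntegral_const, hset,
      Measure.addHaar_preimage_smul _ ht.1.ne', ← mul_assoc, ← ENNReal.ofReal_mul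
        (pow_nonneg ht.1.le n)]
    rw [abs_of_nonneg (by have := ht.1; positivity), finrank_euclideanSpace_fin,
      mul_inv_cancel₀ (pow_pos ht.1 n).ne', ENNReal.ofReal_one, one_mul]
  · have h3 : (Prod.mk t) ⁻¹' (e ⁻¹' ((fun x => a + x) ⁻¹' (s ∩ coneSet a e Ω))) = ∅ := by
      ext y
      simp only [mem_preimage, mem_inter_iff, coneSet, mem_ofPred_eq, add_sub_cancel_left,
        ContinuousLinearEquiv.symm_apply_apply, mem_empty_iff_false, iff_false]
      exact fun h => ht h.2.1
    rw [h3, measure_empty]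
    symm
    refine lintegral_eq_zero_of_ae_eq_zero (Eventually.of_forall fun y => ?_)
    exact indicator_of_notMem (fun h => ht h.2.1) _

theorem lintegral_coneSet {Ω : Set (E n)} (hΩ : IsOpen Ω) {f : E (n + 1) → ℝ≥0∞}
    (hf : Measurable f) :
    ∫⁻ x in coneSet a e Ω, f x = coneFactor e *
      ∫⁻ z in Ioo (0 : ℝ) 1 ×ˢ Ω, ENNReal.ofReal (z.1 ^ n) * f (cone a e z) := by
  rw [restrict_coneSet_eq_map a e hΩ, lintegral_smul_measure,
    lintegral_map hf (continuous_cone a e).measurable]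
  have h := lintegral_withDensity_eq_lintegral_mul
    ((volume : Measure (ℝ × E n)).restrict (Ioo (0 : ℝ) 1 ×ˢ Ω))
    (f := fun z => ENNReal.ofReal (z.1 ^ n)) (by fun_prop)
    (hf.comp (continuous_cone a e).measurable)
  simp only [Function.comp_apply, Pi.mul_apply] at h
  rw [h]
  rfl

theorem integral_coneSet {Ω : Set (E n)} (hΩ : IsOpen Ω) {f : E (n + 1) → ℝ}
    (hf : Measurable f) :
    ∫ x in coneSet a e Ω, f x = coneFactor e *
      ∫ z in Ioo (0 : ℝ) 1 ×ˢ Ω, z.1 ^ n * f (cone a e z) := by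
  rw [restrict_coneSet_eq_map a e hΩ, integral_smul_nnreal_measure,
    integral_map (continuous_cone a e).measurable.aemeasurable
      hf.stronglyMeasurable.aestronglyMeasurable,
    integral_withDensity_eq_integral_toReal_smul (by fun_prop) (by simp), NNReal.smul_def,
    smul_eq_mul]
  congr 1
  refine setIntegral_congr_fun (measurableSet_Ioo.prod hΩ.measurableSet) fun z hz => ?_
  simp only [smul_eq_mul]
  rw [ENNReal.toReal_ofReal (pow_nonneg hz.1.1.le n)]

/-- The volume of a cone: `(n + 1) |C| = c |Ω|`. -/
theorem volume_coneSet {Ω : Set (E n)} (hΩ : IsOpen Ω) :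
    ((n + 1 : ℕ) : ℝ≥0∞) * volume (coneSet a e Ω) = coneFactor e * volume Ω := by
  have h := lintegral_coneSet a e hΩ (f := fun _ => 1) measurable_const
  rw [setLIntegral_one] at h
  rw [h]
  have h1 : ∫⁻ z in Ioo (0 : ℝ) 1 ×ˢ Ω, ENNReal.ofReal (z.1 ^ n) * 1
      = (∫⁻ t in Ioo (0 : ℝ) 1, ENNReal.ofReal (t ^ n)) * volume Ω := by
    simp only [mul_one]
    rw [Measure.volume_eq_prod, ← Measure.prod_restrict, lintegral_prod _ (by fun_prop)]
    simp only [lintegral_const, Measure.restrict_apply_univ]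
    rw [lintegral_mul_const _ (by fun_prop)]
  have h2 : ∫⁻ t in Ioo (0 : ℝ) 1, ENNReal.ofReal (t ^ n) = ENNReal.ofReal (1 / (n + 1)) := by
    rw [← ofReal_integral_eq_lintegral_ofReal]
    · rw [← integral_Ioc_eq_integral_Ioo, ← intervalIntegral.integral_of_le zero_le_one,
        integral_pow]
      simp
    · exact (((continuous_id.pow n).continuousOn (s := Icc 0 1)).integrableOn_Icc).mono_set
        Ioo_subset_Icc_self
    · filter_upwards [ae_restrict_mem measurableSet_Ioo] with t ht using pow_nonneg ht.1.le n
  rw [h1, h2, ← mul_assoc, ← mul_assoc, mul_comm ((n + 1 : ℕ) : ℝ≥0∞), mul_assoc (_ : ℝ≥0∞) _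
    (ENNReal.ofReal _)]
  congr 1
  rw [show ((n + 1 : ℕ) : ℝ≥0∞) = ENNReal.ofReal (n + 1) by
    rw [← ENNReal.ofReal_natCast]; push_cast; rfl, ← ENNReal.ofReal_mul (by positivity),
    mul_one_div_cancel (by positivity), ENNReal.ofReal_one, mul_one]

end

/-! ### The weak gradient in conical coordinates -/

section

variable {n : ℕ}

/-- Integration by parts against the vector field `φ(x) (x - a)`. -/
theorem IsWeakGradient.integral_radial {d : ℕ} {K : Set (E d)} {v : E d → ℝ} {g : E d → E d}
    (h : IsWeakGradient K v g) (hv : IntegrableOn v (interior K)) (hg : IntegrableOn g (interior K))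
    {φ : E d → ℝ} (hφ : IsTest (interior K) φ) (a : E d) :
    ∫ x in interior K, (v x * (d * φ x + fderiv ℝ φ x (x - a))
      + inner ℝ (g x) (x - a) * φ x) = 0 := by
  -- the test function `(xᵢ - aᵢ) φ` in the direction of the `i`-th basis vector
  set b : Fin d → E d := fun i => EuclideanSpace.single i 1 with hb
  set φi : Fin d → E d → ℝ := fun i x => (x i - a i) * φ x with hφi
  have hproj : ∀ i, ContDiff ℝ ∞ (fun x : E d => x i - a i) := fun i => by fun_prop
  have hφd : Differentiable ℝ φ := hφ.contDiff.differentiable (by simp)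
  have htest : ∀ i, IsTest (interior K) (φi i) := fun i =>
    ⟨(hproj i).mul hφ.contDiff, hφ.compact.mul_left, tsupport_mul_subset_right.trans hφ.subset⟩
  have hder : ∀ i x, fderiv ℝ (φi i) x (b i) = φ x + (x i - a i) * fderiv ℝ φ x (b i) := by
    intro i x
    have h1 : HasFDerivAt (fun x : E d => x i - a i)
        (EuclideanSpace.proj i : E d →L[ℝ] ℝ) x :=
      ((EuclideanSpace.proj i : E d →L[ℝ] ℝ).hasFDerivAt (x := x)).sub_const (a i)
    have h2 := (h1.mul (hφd x).hasFDerivAt).fderiv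
    have h3 : fderiv ℝ (φi i) x = (x i - a i) • fderiv ℝ φ x
        + φ x • (EuclideanSpace.proj i : E d →L[ℝ] ℝ) := h2
    rw [h3]
    simp [hb]; ring
  have hxa : ∀ x : E d, x - a = ∑ i, (x i - a i) • b i := by
    intro x
    ext j
    simp [hb, Pi.single_apply]
  have hvi : ∀ i, Integrable (fun x => v x * fderiv ℝ (φi i) x (b i))
      (volume.restrict (interior K)) := by
    intro i
    have hc : Continuous fun x => fderiv ℝ (φi i) x (b i) :=
      ((htest i).contDiff.continuous_fderiv (by simp)).clm_apply continuous_const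
    have hcs : HasCompactSupport fun x => fderiv ℝ (φi i) x (b i) :=
      (htest i).compact.fderiv_apply ℝ (b i)
    obtain ⟨C, hC⟩ := hcs.exists_bound_of_continuous hc
    exact hv.mul_bdd hc.aestronglyMeasurable (Eventually.of_forall hC)
  have hgi : ∀ i, Integrable (fun x => inner ℝ (g x) (b i) * φi i x)
      (volume.restrict (interior K)) := by
    intro i
    obtain ⟨C, hC⟩ := (htest i).exists_bound
    exact (hg.inner_const (b i)).mul_bdd (htest i).continuous.aestronglyMeasurable
      (Eventually.of_forall hC)
  have hsum : ∑ i, ∫ x in interior K,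
      (v x * fderiv ℝ (φi i) x (b i) + inner ℝ (g x) (b i) * φi i x) = 0 := by
    refine Finset.sum_eq_zero fun i _ => ?_
    rw [integral_add (hvi i) (hgi i), h (φi i) (htest i).contDiff (htest i).compact
      (htest i).subset (b i), neg_add_cancel]
  rw [← integral_finsetSum Finset.univ (f := fun i x => v x * fderiv ℝ (φi i) x (b i)
    + inner ℝ (g x) (b i) * φi i x) fun i _ => (hvi i).add (hgi i)] at hsum
  rw [← hsum]
  congr 1; ext x
  rw [Finset.sum_add_distrib]
  congr 1
  · rw [← Finset.mul_sum]
    congr 1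
    simp only [hder, Finset.sum_add_distrib, Finset.sum_const, Finset.card_univ, Fintype.card_fin,
      nsmul_eq_mul]
    congr 1
    conv_lhs => rw [hxa x, map_sum]
    simp
  · conv_lhs => rw [hxa x, inner_sum, Finset.sum_mul]
    refine Finset.sum_congr rfl fun i _ => ?_
    rw [real_inner_smul_right]
    simp only [hφi]; ring

variable {a : E (n + 1)} {e : (ℝ × E n) ≃L[ℝ] E (n + 1)}

/-- The test function `t⁻⁽ⁿ⁺¹⁾ θ(t) η(y)`, transported to the cone. -/
theorem exists_isTest_coneSet {Ω : Set (E n)} {θ : ℝ → ℝ} {η : E n → ℝ}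
    (hθ : IsTest (Ioo 0 1) θ) (hη : IsTest Ω η) :
    ∃ φ : E (n + 1) → ℝ, IsTest (coneSet a e Ω) φ ∧ ∀ z ∈ Ioo (0 : ℝ) 1 ×ˢ Ω,
      φ (cone a e z) = (z.1 ^ (n + 1))⁻¹ * (θ z.1 * η z.2) ∧
      (n + 1) * φ (cone a e z) + fderiv ℝ φ (cone a e z) (cone a e z - a)
        = (z.1 ^ n)⁻¹ * (deriv θ z.1 * η z.2) := by
  set l : E (n + 1) → ℝ := fun x => (e.symm (x - a)).1 with hl
  set π : E (n + 1) → E n := fun x => (e.symm (x - a)).2 with hπ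
  set φ : E (n + 1) → ℝ := fun x => (l x ^ (n + 1))⁻¹ * (θ (l x) * η ((l x)⁻¹ • π x)) with hφ
  have hlc : ContDiff ℝ ∞ l := by fun_prop
  have hπc : ContDiff ℝ ∞ π := by fun_prop
  have hval : ∀ t, t ≠ 0 → ∀ y, φ (cone a e (t, y)) = (t ^ (n + 1))⁻¹ * (θ t * η y) := by
    intro t ht y
    simp only [hφ, hl, hπ, symm_cone_sub]
    rw [smul_smul, inv_mul_cancel₀ ht, one_smul]
  have hcomp : IsCompact (cone a e '' (tsupport θ ×ˢ tsupport η)) :=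
    (IsCompact.prod hθ.compact hη.compact).image (continuous_cone a e)
  have hsupp : Function.support φ ⊆ cone a e '' (tsupport θ ×ˢ tsupport η) := by
    intro x hx
    have h1 : θ (l x) ≠ 0 := fun h => hx (by simp [hφ, h])
    have h2 : η ((l x)⁻¹ • π x) ≠ 0 := fun h => hx (by simp [hφ, h])
    have h0 : l x ≠ 0 := (hθ.subset (subset_tsupport _ h1)).1.ne'
    refine ⟨(l x, (l x)⁻¹ • π x), ⟨subset_tsupport _ h1, subset_tsupport _ h2⟩, ?_⟩
    have h3 : ((l x, l x • (l x)⁻¹ • π x) : ℝ × E n) = e.symm (x - a) := by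
      rw [smul_smul, mul_inv_cancel₀ h0, one_smul]
    rw [cone, h3, ContinuousLinearEquiv.apply_symm_apply]
    abel
  have hts : tsupport φ ⊆ cone a e '' (tsupport θ ×ˢ tsupport η) :=
    closure_minimal hsupp hcomp.isClosed
  have hsub : cone a e '' (tsupport θ ×ˢ tsupport η) ⊆ coneSet a e Ω := by
    rintro _ ⟨z, hz, rfl⟩
    exact cone_mem_coneSet ⟨hθ.subset hz.1, hη.subset hz.2⟩
  have hsmooth : ContDiff ℝ ∞ φ := by
    refine contDiff_iff_contDiffAt.2 fun x => ?_
    by_cases hx : x ∈ tsupport φ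
    swap
    · exact (contDiffAt_const (c := (0 : ℝ))).congr_of_eventuallyEq
        (notMem_tsupport_iff_eventuallyEq.1 hx)
    have h0 : l x ≠ 0 := (hsub (hts hx)).1.1.ne'
    have h1 : ContDiffAt ℝ ∞ (fun x => (l x)⁻¹ • π x) x :=
      (hlc.contDiffAt.inv h0).smul hπc.contDiffAt
    exact ((hlc.contDiffAt.pow _).inv (pow_ne_zero _ h0)).mul
      ((hθ.contDiff.contDiffAt.comp x hlc.contDiffAt).mul (hη.contDiff.contDiffAt.comp x h1))
  refine ⟨φ, ⟨hsmooth, hcomp.of_isClosed_subset (isClosed_tsupport φ) hts, hts.trans hsub⟩,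
    fun z hz => ⟨hval z.1 hz.1.1.ne' z.2, ?_⟩⟩
  obtain ⟨t, y⟩ := z
  have ht : (0 : ℝ) < t := hz.1.1
  rw [hval t ht.ne' y]
  -- the radial derivative is the derivative of `s ↦ φ (cone (s, y))` at `s = t`, times `t`
  have hcurve : HasDerivAt (fun s : ℝ => cone a e (s, y)) (e (1, y)) t := by
    have h1 : (fun s : ℝ => cone a e (s, y)) = fun s => a + s • e (1, y) := by
      funext s
      rw [← cone_sub a e (s, y)]; abel
    rw [h1]
    simpa using ((hasDerivAt_id t).smul_const (e (1, y))).const_add a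
  have hd1 : HasDerivAt (fun s : ℝ => φ (cone a e (s, y)))
      (fderiv ℝ φ (cone a e (t, y)) (e (1, y))) t :=
    ((hsmooth.differentiable (by simp)) _).hasFDerivAt.comp_hasDerivAt t hcurve
  have hd2 : HasDerivAt (fun s : ℝ => (s ^ (n + 1))⁻¹ * (θ s * η y))
      (-(((n + 1 : ℕ) : ℝ) * t ^ n) / (t ^ (n + 1)) ^ 2 * (θ t * η y)
        + (t ^ (n + 1))⁻¹ * (deriv θ t * η y)) t :=
    ((hasDerivAt_pow (n + 1) t).fun_inv (pow_ne_zero _ ht.ne')).mul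
      ((hθ.hasDerivAt t).mul_const (η y))
  have hd3 := hd1.unique (hd2.congr_of_eventuallyEq (by
    filter_upwards [lt_mem_nhds ht] with s hs using hval s hs.ne' y))
  rw [cone_sub, map_smul, hd3, smul_eq_mul]
  push_cast
  field_simp
  ring

/-- The weak equation in conical coordinates. -/
theorem IsWeakGradient.integral_cone {K : Set (E (n + 1))} {v : E (n + 1) → ℝ}
    {g : E (n + 1) → E (n + 1)} (h : IsWeakGradient K v g) (hvm : Measurable v)
    (hgm : Measurable g) (hv : IntegrableOn v (interior K)) (hg : IntegrableOn g (interior K))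
    {Ω : Set (E n)} (hΩ : IsOpen Ω) (hC : coneSet a e Ω ⊆ interior K) {θ : ℝ → ℝ} {η : E n → ℝ}
    (hθ : IsTest (Ioo 0 1) θ) (hη : IsTest Ω η) :
    ∫ z in Ioo (0 : ℝ) 1 ×ˢ Ω, (v (cone a e z) * deriv θ z.1
      + inner ℝ (g (cone a e z)) (e (1, z.2)) * θ z.1) * η z.2 = 0 := by
  obtain ⟨φ, hφ, hφz⟩ := exists_isTest_coneSet (a := a) (e := e) hθ hη
  have h1 := h.integral_radial hv hg (hφ.mono hC) a
  have hfm : Measurable fun x => fderiv ℝ φ x (x - a) :=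
    ((hφ.contDiff.continuous_fderiv (by simp)).clm_apply (by fun_prop)).measurable
  have hφm : Measurable φ := hφ.continuous.measurable
  rw [setIntegral_eq_of_subset_of_forall_sdiff_eq_zero isOpen_interior.measurableSet hC
    (fun x hx => by
      have h0 : x ∉ tsupport φ := fun h' => hx.2 (hφ.subset h')
      rw [image_eq_zero_of_notMem_tsupport h0, fderiv_of_notMem_tsupport ℝ h0]
      simp), integral_coneSet a e hΩ (by fun_prop)] at h1
  have h2 := (mul_eq_zero.1 h1).resolve_left (by simpa using (coneFactor_pos e).ne')
  refine Eq.trans ?_ h2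
  refine setIntegral_congr_fun (measurableSet_Ioo.prod hΩ.measurableSet) fun z hz => ?_
  obtain ⟨h3, h4⟩ := hφz z hz
  have ht : z.1 ≠ 0 := hz.1.1.ne'
  push_cast
  rw [h4, h3, cone_sub, real_inner_smul_right]
  field_simp
  ring

end

/-! ### The trace on the base of a cone -/

section

variable {n : ℕ} {a : E (n + 1)} {e : (ℝ × E n) ≃L[ℝ] E (n + 1)}

theorem lintegral_Ioo_prod {Ω : Set (E n)} {F : ℝ × E n → ℝ≥0∞} (hF : Measurable F) (b c : ℝ) :
    ∫⁻ z in Ioo b c ×ˢ Ω, F z = ∫⁻ y in Ω, ∫⁻ t in Ioo b c, F (t, y) := by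
  rw [Measure.volume_eq_prod, ← Measure.prod_restrict, lintegral_prod_symm _ hF.aemeasurable]

theorem integrableOn_comp_cone {Ω : Set (E n)} (hΩ : IsOpen Ω) {F : Type*} [NormedAddCommGroup F]
    [MeasurableSpace F] [BorelSpace F] [SecondCountableTopology F]
    {f : E (n + 1) → F} (hfm : Measurable f) (hf : IntegrableOn f (coneSet a e Ω)) {δ : ℝ}
    (hδ : 0 < δ) : IntegrableOn (fun z => f (cone a e z)) (Ioo δ 1 ×ˢ Ω) := by
  refine ⟨(hfm.comp (continuous_cone a e).measurable).aestronglyMeasurable, ?_⟩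
  have h1 : ∫⁻ x in coneSet a e Ω, ‖f x‖ₑ < ⊤ := hf.2
  rw [lintegral_coneSet a e hΩ hfm.enorm] at h1
  have h2 : ∫⁻ z in Ioo (0 : ℝ) 1 ×ˢ Ω, ENNReal.ofReal (z.1 ^ n) * ‖f (cone a e z)‖ₑ < ⊤ :=
    (ENNReal.mul_lt_top_iff.1 h1).elim (fun h => h.2) (fun h => h.elim
      (fun h => absurd h (by simpa using (coneFactor_pos e).ne')) (fun h => by simp [h]))
  have h3 : ENNReal.ofReal (δ ^ n) * ∫⁻ z in Ioo δ 1 ×ˢ Ω, ‖f (cone a e z)‖ₑ < ⊤ := by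
    refine lt_of_le_of_lt ?_ h2
    rw [← lintegral_const_mul (f := fun z => ‖f (cone a e z)‖ₑ) _
      (hfm.comp (continuous_cone a e).measurable).enorm]
    refine le_trans (setLIntegral_mono' (measurableSet_Ioo.prod hΩ.measurableSet) fun z hz => ?_)
      (lintegral_mono_set (prod_mono_left (Ioo_subset_Ioo_left hδ.le)))
    gcongr
    exact hz.1.1.le
  exact (ENNReal.mul_lt_top_iff.1 h3).elim (fun h => h.2) (fun h => h.elim
    (fun h => absurd h (by simpa using pow_pos hδ n)) (fun h => by simp [HasFiniteIntegral, h]))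

/-- The trace of `v` on the base of a cone: the end values `w` of `v` along almost every ray,
together with the weighted one-dimensional estimates integrated over the base. -/
theorem exists_coneTrace {K : Set (E (n + 1))} {v : E (n + 1) → ℝ} {g : E (n + 1) → E (n + 1)}
    (h : IsWeakGradient K v g) (hvm : Measurable v) (hgm : Measurable g)
    (hv : IntegrableOn v (interior K)) (hg : IntegrableOn g (interior K)) {Ω : Set (E n)}
    (hΩ : IsOpen Ω) (hC : coneSet a e Ω ⊆ interior K) {D : ℝ} (hD : ∀ y ∈ Ω, ‖e (1, y)‖ ≤ D) :
    ∃ w : E n → ℝ, Measurable w ∧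
      (∀ p : ℝ, 1 ≤ p → coneFactor e * ∫⁻ y in Ω, ENNReal.ofReal (|w y| ^ p) ≤
        ∫⁻ x in coneSet a e Ω,
          ENNReal.ofReal ((n + 1) * |v x| ^ p + p * |v x| ^ (p - 1) * (D * ‖g x‖))) ∧
      ∀ᵐ y ∂(volume.restrict Ω), ∀ᵐ t ∂(volume.restrict (Ioo (0 : ℝ) 1)),
        ‖v (cone a e (t, y)) - w y‖ₑ
          ≤ ∫⁻ s in Ioo t 1, ENNReal.ofReal D * ‖g (cone a e (s, y))‖ₑ := by
  have hcm := (continuous_cone a e).measurable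
  set V : ℝ × E n → ℝ := fun z => v (cone a e z)
  set G : ℝ × E n → ℝ := fun z => inner ℝ (g (cone a e z)) (e (1, z.2))
  have hVm : Measurable V := hvm.comp hcm
  have hem : Measurable fun z : ℝ × E n => e (1, z.2) :=
    (Continuous.measurable (by fun_prop))
  have hGm : Measurable G := (hgm.comp hcm).inner hem
  have hGle : ∀ z : ℝ × E n, z.2 ∈ Ω → |G z| ≤ D * ‖g (cone a e z)‖ := by
    intro z hz
    calc |G z| ≤ ‖g (cone a e z)‖ * ‖e (1, z.2)‖ := abs_real_inner_le_norm _ _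
      _ ≤ ‖g (cone a e z)‖ * D := by gcongr; exact hD _ hz
      _ = _ := mul_comm _ _
  have hVi : ∀ δ ∈ Ioo (0 : ℝ) 1, IntegrableOn V (Ioo δ 1 ×ˢ Ω) := fun δ hδ =>
    integrableOn_comp_cone hΩ hvm (hv.mono_set hC) hδ.1
  have hGi : ∀ δ ∈ Ioo (0 : ℝ) 1, IntegrableOn G (Ioo δ 1 ×ˢ Ω) := fun δ hδ => by
    have h1 := (integrableOn_comp_cone (a := a) (e := e) hΩ hgm (hg.mono_set hC) hδ.1).norm
    refine (h1.const_mul D).mono' hGm.aestronglyMeasurable ?_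
    filter_upwards [ae_restrict_mem (measurableSet_Ioo.prod hΩ.measurableSet)] with z hz
    exact hGle z hz.2
  obtain ⟨w, hwm, hw⟩ := exists_ae_eq_sub_integral hΩ hVm hGm hVi hGi
    (fun θ η hθ hη => h.integral_cone hvm hgm hv hg hΩ hC hθ hη)
  refine ⟨w, hwm, fun p hp => ?_, ?_⟩
  · rw [lintegral_coneSet a e hΩ (by fun_prop)]
    refine mul_le_mul_right ?_ _
    rw [lintegral_Ioo_prod (by fun_prop)]
    refine lintegral_mono_ae ?_
    filter_upwards [hw, ae_restrict_mem hΩ.measurableSet] with y hy hyΩ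
    refine (ofReal_rpow_le_lintegral n hp hy.1 hy.2).trans ?_
    refine setLIntegral_mono' measurableSet_Ioo fun t ht => ?_
    rw [← ENNReal.ofReal_mul (pow_nonneg ht.1.le n)]
    refine ENNReal.ofReal_le_ofReal ?_
    have h1 := hGle (t, y) hyΩ
    have h2 : 0 ≤ t ^ n := pow_nonneg ht.1.le n
    have h3 : 0 ≤ p * |V (t, y)| ^ (p - 1) := by positivity
    exact mul_le_mul_of_nonneg_left (add_le_add le_rfl (mul_le_mul_of_nonneg_left h1 h3)) h2
  · filter_upwards [hw, ae_restrict_mem hΩ.measurableSet] with y hy hyΩ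
    filter_upwards [hy.2, ae_restrict_mem measurableSet_Ioo] with t ht htI
    have h1 : v (cone a e (t, y)) - w y = -∫ s in Ioo t 1, G (s, y) := by
      change V (t, y) - w y = _
      rw [ht, intervalIntegral.integral_of_le htI.2.le, integral_Ioc_eq_integral_Ioo]
      ring
    rw [h1, enorm_neg]
    refine (enorm_integral_le_lintegral_enorm _).trans (lintegral_mono fun s => ?_)
    rw [← ofReal_norm, ← ofReal_norm, Real.norm_eq_abs,
      ← ENNReal.ofReal_mul ((norm_nonneg _).trans (hD y hyΩ))]
    exact ENNReal.ofReal_le_ofReal (hGle (s, y) hyΩ)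

/-- Points of the cone close to a base point `j y` have conical coordinates close to `(1, y)`. -/
theorem exists_cone_mem_ball_imp {Ω : Set (E n)} {D : ℝ} (hD : ∀ y ∈ Ω, ‖e (1, y)‖ ≤ D) :
    ∃ M : ℝ, 0 < M ∧ ∀ y, ∀ r > 0, ∀ z ∈ Ioo (0 : ℝ) 1 ×ˢ Ω,
      cone a e z ∈ Metric.ball (a + e (1, y)) r →
        z.1 ∈ Ioo (1 - M * r) 1 ∧ z.2 ∈ Metric.closedBall y (M * r) := by
  obtain ⟨N, hN, hNb⟩ := (e.symm : E (n + 1) →L[ℝ] ℝ × E n).bound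
  refine ⟨N * (N * |D| + 1), by positivity, fun y r hr z hz hball => ?_⟩
  obtain ⟨t, y'⟩ := z
  obtain ⟨⟨ht0, ht1⟩, hy'⟩ := hz
  have hy'n : ‖y'‖ ≤ N * |D| := by
    have h1 := hNb (e (1, y'))
    simp only [ContinuousLinearEquiv.coe_coe, ContinuousLinearEquiv.symm_apply_apply] at h1
    exact (norm_snd_le (1, y')).trans (h1.trans (by gcongr; exact (hD y' hy').trans (le_abs_self D)))
  have h2 : ‖((t - 1, t • y' - y) : ℝ × E n)‖ < N * r := by
    have h3 := hNb (cone a e (t, y') - (a + e (1, y)))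
    have h4 : e.symm (cone a e (t, y') - (a + e (1, y))) = (t - 1, t • y' - y) := by
      simp [cone]
    simp only [ContinuousLinearEquiv.coe_coe, h4] at h3
    rw [mem_ball_iff_norm] at hball
    exact h3.trans_lt (by gcongr)
  have h5 : 1 - t < N * r := by
    have := (norm_fst_le ((t - 1, t • y' - y) : ℝ × E n)).trans_lt h2
    simp only [Real.norm_eq_abs] at this
    linarith [neg_abs_le (t - 1)]
  have h6 : ‖t • y' - y‖ ≤ N * r := (norm_snd_le ((t - 1, t • y' - y) : ℝ × E n)).trans h2.le
  have hle : N * r ≤ N * (N * |D| + 1) * r := by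
    have : 0 ≤ N * (N * |D|) * r := by positivity
    linarith
  have h8 : ‖y' - t • y'‖ = (1 - t) * ‖y'‖ := by
    rw [show y' - t • y' = (1 - t) • y' by rw [sub_smul, one_smul], norm_smul,
      Real.norm_of_nonneg (by linarith)]
  refine ⟨⟨by linarith, ht1⟩, ?_⟩
  rw [Metric.mem_closedBall, dist_eq_norm]
  calc ‖y' - y‖ ≤ ‖y' - t • y'‖ + ‖t • y' - y‖ := norm_sub_le_norm_sub_add_norm_sub _ _ _
    _ ≤ (N * r) * (N * |D|) + N * r := by
      rw [h8]; gcongr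
    _ = _ := by ring

/-- Almost every base point is a Lebesgue point of `v` relative to the cone, with value `w`. The
average of `|v - w y|` is bounded by the averages over a ball of the base of `|w - w y|` and of the
integrals `Gk k` of `D |g|` over the last pieces of length `δ k` of the rays. As the radius tends to
`0` these tend to `0` and to `Gk k y`, and the latter tends to `0` with `δ k`. -/
theorem ae_tendsto_lintegral_coneSet {v : E (n + 1) → ℝ} {g : E (n + 1) → E (n + 1)}
    (hvm : Measurable v) (hgm : Measurable g) {Ω : Set (E n)} (hΩ : IsOpen Ω)
    (hg : IntegrableOn g (coneSet a e Ω)) {D : ℝ} (hD : ∀ y ∈ Ω, ‖e (1, y)‖ ≤ D) {w : E n → ℝ}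
    (hwm : Measurable w) (hwi : IntegrableOn w Ω)
    (hw : ∀ᵐ y ∂(volume.restrict Ω), ∀ᵐ t ∂(volume.restrict (Ioo (0 : ℝ) 1)),
      ‖v (cone a e (t, y)) - w y‖ₑ
        ≤ ∫⁻ s in Ioo t 1, ENNReal.ofReal D * ‖g (cone a e (s, y))‖ₑ) :
    ∀ᵐ y ∂(volume.restrict Ω), Tendsto (fun r : ℝ =>
      (∫⁻ x in coneSet a e Ω ∩ Metric.ball (a + e (1, y)) r, ‖v x - w y‖ₑ)
        / ENNReal.ofReal (r ^ (n + 1))) (𝓝[>] 0) (𝓝 0) := by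
  have hcm := (continuous_cone a e).measurable
  obtain ⟨M, hM, hMball⟩ := exists_cone_mem_ball_imp (a := a) hD
  set F : ℝ × E n → ℝ≥0∞ := fun z => ENNReal.ofReal D * ‖g (cone a e z)‖ₑ with hF
  have hFm : Measurable F := by fun_prop
  set δ : ℕ → ℝ := fun k => 1 / ((k : ℝ) + 2) with hδ
  have hδ0 : ∀ k, 0 < δ k := fun k => by positivity
  have hδ1 : ∀ k, δ k ≤ 1 / 2 := fun k =>
    one_div_le_one_div_of_le (by norm_num) (by linarith [k.cast_nonneg (α := ℝ)])
  have hδlim : Tendsto δ atTop (𝓝 0) :=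
    tendsto_const_nhds.div_atTop (tendsto_atTop_add_const_right _ _ tendsto_natCast_atTop_atTop)
  set Gk : ℕ → E n → ℝ≥0∞ := fun k y => Ω.indicator (fun y => ∫⁻ s in Ioo (1 - δ k) 1, F (s, y)) y
    with hGk
  have hGkm : ∀ k, Measurable (Gk k) := fun k =>
    (Measurable.lintegral_prod_left' (f := F) hFm).indicator hΩ.measurableSet
  have hhalf : ∫⁻ y in Ω, ∫⁻ s in Ioo (1 / 2 : ℝ) 1, F (s, y) ≠ ⊤ := by
    rw [← lintegral_Ioo_prod hFm]
    have h1 := (integrableOn_comp_cone (a := a) (e := e) hΩ hgm hg one_half_pos).2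
    simp only [hF]
    rw [lintegral_const_mul _ (by fun_prop)]
    exact ENNReal.mul_ne_top ENNReal.ofReal_ne_top h1.ne
  have hGkint : ∀ k, ∫⁻ y, Gk k y ≠ ⊤ := by
    intro k
    simp only [hGk]
    rw [lintegral_indicator hΩ.measurableSet]
    refine ne_top_of_le_ne_top hhalf (lintegral_mono fun y => lintegral_mono_set ?_)
    exact Ioo_subset_Ioo_left (by linarith [hδ1 k])
  have hGk0 : ∀ᵐ y ∂(volume.restrict Ω), Tendsto (fun k => Gk k y) atTop (𝓝 0) := by
    filter_upwards [ae_lt_top' (Measurable.lintegral_prod_left' (f := F) hFm).aemeasurable hhalf,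
      ae_restrict_mem hΩ.measurableSet] with y hy hyΩ
    have h1 : ∀ k, Gk k y = ∫⁻ s in Ioo (1 - δ k) 1, F (s, y) ∂(volume.restrict (Ioo (1 / 2) 1)) := by
      intro k
      simp only [hGk, indicator_of_mem hyΩ]
      rw [Measure.restrict_restrict measurableSet_Ioo, inter_eq_left.2
        (Ioo_subset_Ioo_left (by linarith [hδ1 k]))]
    simp only [h1]
    refine tendsto_setLIntegral_zero hy.ne ?_
    have h2 : Tendsto (fun k => ENNReal.ofReal (δ k)) atTop (𝓝 0) := by
      simpa [Function.comp_def] using (ENNReal.continuous_ofReal.tendsto 0).comp hδlim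
    refine tendsto_of_tendsto_of_tendsto_of_le_of_le tendsto_const_nhds h2
      (fun _ => zero_le) fun k => ?_
    refine (Measure.restrict_apply_le _ _).trans ?_
    simp
  set w' : E n → ℝ := Ω.indicator w with hw'
  have hw'i : LocallyIntegrable w' :=
    ((integrable_indicator_iff hΩ.measurableSet).2 hwi).locallyIntegrable
  set vf := Besicovitch.vitaliFamily (volume : Measure (E n))
  have hL1 := ae_restrict_of_ae (s := Ω) (vf.ae_tendsto_lintegral_enorm_sub_div hw'i)
  have hL2 : ∀ᵐ y ∂(volume.restrict Ω), ∀ k, Tendsto (fun s => (∫⁻ x in s, Gk k x) / volume s)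
      (vf.filterAt y) (𝓝 (Gk k y)) :=
    ae_all_iff.2 fun k => ae_restrict_of_ae (vf.ae_tendsto_lintegral_div' (hGkm k) (hGkint k))
  set β : ℝ≥0∞ := volume (Metric.closedBall (0 : E n) 1) with hβ
  have hβtop : β ≠ ⊤ := (isCompact_closedBall _ _).measure_lt_top.ne
  set A : ℝ≥0∞ := coneFactor e * (ENNReal.ofReal (M ^ (n + 1)) * β) with hA
  have hAtop : A ≠ ⊤ :=
    ENNReal.mul_ne_top ENNReal.coe_ne_top (ENNReal.mul_ne_top ENNReal.ofReal_ne_top hβtop)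
  filter_upwards [hL1, hL2, hGk0, ae_restrict_mem hΩ.measurableSet] with y hy1 hy2 hy3 hyΩ
  have hball : Tendsto (fun r : ℝ => Metric.closedBall y (M * r)) (𝓝[>] 0) (vf.filterAt y) := by
    refine (Besicovitch.tendsto_filterAt volume y).comp (tendsto_nhdsWithin_iff.2 ⟨?_, ?_⟩)
    · have : Tendsto (fun r : ℝ => M * r) (𝓝 0) (𝓝 (M * 0)) := tendsto_const_nhds.mul tendsto_id
      rw [mul_zero] at this
      exact tendsto_nhdsWithin_of_tendsto_nhds this
    · filter_upwards [self_mem_nhdsWithin] with r hr using mul_pos hM hr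
  -- the estimate at scale `r`, for each truncation level `k`
  have main : ∀ k, ∀ᶠ r : ℝ in 𝓝[>] 0,
      (∫⁻ x in coneSet a e Ω ∩ Metric.ball (a + e (1, y)) r, ‖v x - w y‖ₑ)
        / ENNReal.ofReal (r ^ (n + 1)) ≤
      A * ((∫⁻ x in Metric.closedBall y (M * r), ‖w' x - w' y‖ₑ)
          / volume (Metric.closedBall y (M * r))
        + (∫⁻ x in Metric.closedBall y (M * r), Gk k x)
          / volume (Metric.closedBall y (M * r))) := by
    intro k
    have hsmall : Ioo (0 : ℝ) (δ k / M) ∈ 𝓝[>] (0 : ℝ) := Ioo_mem_nhdsGT (by have := hδ0 k; positivity)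
    filter_upwards [hsmall] with r hr
    set ρ := M * r with hρ
    have hρ0 : 0 < ρ := mul_pos hM hr.1
    have hρδ : ρ ≤ δ k := by
      have := hr.2; rw [lt_div_iff₀ hM] at this; linarith
    set B := Metric.closedBall y ρ with hB
    have hBm : MeasurableSet B := Metric.isClosed_closedBall.measurableSet
    have hvolB : volume B = ENNReal.ofReal (ρ ^ n) * β := by
      rw [hB, Measure.addHaar_closedBall' _ _ hρ0.le, finrank_euclideanSpace_fin]
    have hB0 : volume B ≠ 0 := (Metric.measure_closedBall_pos _ _ hρ0).ne'
    have hBtop : volume B ≠ ⊤ := (isCompact_closedBall _ _).measure_lt_top.ne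
    have hGkm' := hGkm k
    have hw'm : Measurable w' := hwm.indicator hΩ.measurableSet
    have step : ∫⁻ x in coneSet a e Ω ∩ Metric.ball (a + e (1, y)) r, ‖v x - w y‖ₑ
        ≤ coneFactor e * (ENNReal.ofReal ρ *
          ∫⁻ x in B, (‖w' x - w' y‖ₑ + Gk k x)) := by
      set f : E (n + 1) → ℝ≥0∞ :=
        (Metric.ball (a + e (1, y)) r).indicator fun x => ‖v x - w y‖ₑ with hf
      have hfm : Measurable f :=
        (hvm.sub_const _).enorm.indicator Metric.isOpen_ball.measurableSet
      set f' : ℝ × E n → ℝ≥0∞ := (Ioo (1 - ρ) 1 ×ˢ B).indicator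
        fun z => ‖v (cone a e z) - w y‖ₑ with hf'
      have hf'm : Measurable f' :=
        ((hvm.comp hcm).sub_const _).enorm.indicator (measurableSet_Ioo.prod hBm)
      have e1 : ∫⁻ x in coneSet a e Ω ∩ Metric.ball (a + e (1, y)) r, ‖v x - w y‖ₑ
          = ∫⁻ x in coneSet a e Ω, f x := by
        rw [hf, lintegral_indicator Metric.isOpen_ball.measurableSet,
          Measure.restrict_restrict Metric.isOpen_ball.measurableSet, inter_comm]
      rw [e1, lintegral_coneSet a e hΩ hfm]
      refine mul_le_mul_right ?_ _
      calc ∫⁻ z in Ioo (0 : ℝ) 1 ×ˢ Ω, ENNReal.ofReal (z.1 ^ n) * f (cone a e z)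
          ≤ ∫⁻ z in Ioo (0 : ℝ) 1 ×ˢ Ω, f' z := by
            refine setLIntegral_mono' (measurableSet_Ioo.prod hΩ.measurableSet) fun z hz => ?_
            by_cases hzb : cone a e z ∈ Metric.ball (a + e (1, y)) r
            · have h1 := hMball y r hr.1 z hz hzb
              rw [hf, hf', indicator_of_mem hzb, indicator_of_mem (show z ∈ _ from h1)]
              have h2 : ENNReal.ofReal (z.1 ^ n) ≤ 1 := by
                rw [ENNReal.ofReal_le_one]
                exact pow_le_one₀ hz.1.1.le hz.1.2.le
              exact mul_le_of_le_one_left zero_le h2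
            · rw [hf, indicator_of_notMem hzb, mul_zero]; exact zero_le
        _ = ∫⁻ y' in Ω, ∫⁻ t in Ioo (0 : ℝ) 1, f' (t, y') := lintegral_Ioo_prod hf'm 0 1
        _ ≤ ∫⁻ y' in Ω, B.indicator
              (fun x => ENNReal.ofReal ρ * (‖w' x - w' y‖ₑ + Gk k x)) y' := by
            refine lintegral_mono_ae ?_
            filter_upwards [hw, ae_restrict_mem hΩ.measurableSet] with y' hy' hy'Ω
            by_cases hyB : y' ∈ B
            · rw [indicator_of_mem hyB]
              calc ∫⁻ t in Ioo (0 : ℝ) 1, f' (t, y')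
                  ≤ ∫⁻ t in Ioo (0 : ℝ) 1, (Ioo (1 - ρ) 1).indicator
                      (fun _ => ‖w' y' - w' y‖ₑ + Gk k y') t := by
                    refine lintegral_mono_ae ?_
                    filter_upwards [hy'] with t ht
                    by_cases htI : t ∈ Ioo (1 - ρ) 1
                    · rw [hf', indicator_of_mem (show (t, y') ∈ Ioo (1 - ρ) 1 ×ˢ B from ⟨htI, hyB⟩),
                        indicator_of_mem htI]
                      simp only [hw', hGk, indicator_of_mem hyΩ, indicator_of_mem hy'Ω]
                      calc ‖v (cone a e (t, y')) - w y‖ₑ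
                          = ‖(w y' - w y) + (v (cone a e (t, y')) - w y')‖ₑ := by
                            congr 1; ring
                        _ ≤ ‖w y' - w y‖ₑ + ‖v (cone a e (t, y')) - w y'‖ₑ := enorm_add_le _ _
                        _ ≤ _ := by
                            gcongr
                            refine ht.trans (lintegral_mono_set (Ioo_subset_Ioo_left ?_))
                            linarith [htI.1]
                    · rw [hf', indicator_of_notMem (fun h => htI h.1)]; exact zero_le
                _ ≤ ENNReal.ofReal ρ * (‖w' y' - w' y‖ₑ + Gk k y') := by
                    rw [lintegral_indicator measurableSet_Ioo, setLIntegral_const, mul_comm]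
                    gcongr
                    refine (Measure.restrict_apply_le _ _).trans ?_
                    simp
            · have : ∀ t, f' (t, y') = 0 := fun t => indicator_of_notMem (fun h => hyB h.2) _
              simp [this]
        _ ≤ ∫⁻ y', B.indicator
              (fun x => ENNReal.ofReal ρ * (‖w' x - w' y‖ₑ + Gk k x)) y' :=
            setLIntegral_le_lintegral _ _
        _ = ENNReal.ofReal ρ * ∫⁻ x in B, (‖w' x - w' y‖ₑ + Gk k x) := by
            rw [lintegral_indicator hBm, lintegral_const_mul _ (by fun_prop)]
    rw [lintegral_add_right _ hGkm'] at step
    rw [← ENNReal.add_div]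
    set Q := ∫⁻ x in B, ‖w' x - w' y‖ₑ
    set Q' := ∫⁻ x in B, Gk k x
    have hrn : ENNReal.ofReal (r ^ (n + 1)) ≠ 0 := by
      have := pow_pos hr.1 (n + 1); simpa using this
    refine ENNReal.div_le_of_le_mul ?_
    refine step.trans (le_of_eq ?_)
    have h1 : Q + Q' = (Q + Q') / volume B * volume B :=
      (ENNReal.div_mul_cancel hB0 hBtop).symm
    have h2 : ENNReal.ofReal ρ * ENNReal.ofReal (ρ ^ n)
        = ENNReal.ofReal (M ^ (n + 1)) * ENNReal.ofReal (r ^ (n + 1)) := by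
      rw [← ENNReal.ofReal_mul hρ0.le, ← ENNReal.ofReal_mul (by positivity), ← pow_succ',
        hρ, mul_pow]
    conv_lhs => rw [h1]
    rw [hA]
    calc (coneFactor e : ℝ≥0∞) * (ENNReal.ofReal ρ * ((Q + Q') / volume B * volume B))
        = coneFactor e * ((ENNReal.ofReal ρ * ENNReal.ofReal (ρ ^ n)) * β *
            ((Q + Q') / volume B)) := by
          generalize (Q + Q') / volume B = X
          rw [hvolB]; ring
      _ = _ := by rw [h2]; ring
  rw [ENNReal.tendsto_nhds_zero]
  intro ε hε
  have hlim : Tendsto (fun k => A * (0 + Gk k y)) atTop (𝓝 (A * (0 + 0))) :=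
    ENNReal.Tendsto.const_mul (tendsto_const_nhds.add hy3) (Or.inr hAtop)
  rw [add_zero, mul_zero] at hlim
  obtain ⟨k, hk⟩ := (hlim.eventually (gt_mem_nhds hε)).exists
  have hlim2 := ENNReal.Tendsto.const_mul (a := A) ((hy1.comp hball).add ((hy2 k).comp hball))
    (Or.inr hAtop)
  filter_upwards [main k, hlim2.eventually (gt_mem_nhds hk)] with r h1 h2
  exact h1.trans h2.le

end

/-! ### Facets of a simplex and their parametrizations -/

section

variable {n : ℕ}

/-- The vertices of a nondegenerate simplex of full dimension, as an affine basis; its coordinates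
are the barycentric coordinates of the simplex. -/
def vertexBasis {d : ℕ} (T : Affine.Simplex ℝ (E d) d) : AffineBasis (Fin (d + 1)) ℝ (E d) :=
  ⟨T.points, T.independent,
    (T.independent.affineSpan_eq_top_iff_card_eq_finrank_add_one).2 (by simp)⟩

/-- The relative interior of the facet of `T` opposite to the `i`-th vertex. -/
def openFacet {d : ℕ} (T : Affine.Simplex ℝ (E d) d) (i : Fin (d + 1)) : Set (E d) :=
  {x | (vertexBasis T).coord i x = 0 ∧ ∀ k, k ≠ i → 0 < (vertexBasis T).coord k x}

section Simplex

variable {d : ℕ} (T : Affine.Simplex ℝ (E d) d)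

theorem coord_vertex (i k : Fin (d + 1)) :
    (vertexBasis T).coord k (T.points i) = if k = i then 1 else 0 :=
  (vertexBasis T).coord_apply k i

theorem continuous_coord (k : Fin (d + 1)) : Continuous ((vertexBasis T).coord k) :=
  continuous_barycentric_coord _ _

theorem body_eq : body T = {x | ∀ k, 0 ≤ (vertexBasis T).coord k x} :=
  (vertexBasis T).convexHull_eq_nonneg_coord

theorem interior_body_eq : interior (body T) = {x | ∀ k, 0 < (vertexBasis T).coord k x} :=
  (vertexBasis T).interior_convexHull

theorem convex_body : Convex ℝ (body T) := convex_convexHull _ _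

theorem isCompact_body : IsCompact (body T) := (finite_range _).isCompact_convexHull ℝ

theorem facet_eq (i : Fin (d + 1)) :
    facet T i = {x | x ∈ body T ∧ (vertexBasis T).coord i x = 0} := by
  ext x
  constructor
  · intro hx
    refine ⟨convexHull_mono (image_subset_range _ _) hx, ?_⟩
    have hconv : Convex ℝ {x : E d | (vertexBasis T).coord i x = 0} :=
      (convex_singleton (0 : ℝ)).affine_preimage ((vertexBasis T).coord i)
    refine convexHull_min ?_ hconv hx
    rintro _ ⟨k, hk, rfl⟩
    rw [mem_ofPred_eq, coord_vertex, if_neg (Ne.symm hk)]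
  · rintro ⟨hx, h0⟩
    rw [body_eq] at hx
    have h1 := (vertexBasis T).linear_combination_coord_eq_self x
    have h2 := (vertexBasis T).sum_coord_apply_eq_one x
    rw [← Finset.add_sum_erase _ _ (Finset.mem_univ i), h0, zero_smul, zero_add] at h1
    rw [← Finset.add_sum_erase _ _ (Finset.mem_univ i), h0, zero_add] at h2
    rw [← h1]
    refine (convex_convexHull ℝ _).sum_mem (fun k _ => hx k) h2 fun k hk => ?_
    exact subset_convexHull ℝ _ ⟨k, (Finset.mem_erase.1 hk).1, rfl⟩

theorem openFacet_subset_facet (i : Fin (d + 1)) : openFacet T i ⊆ facet T i := by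
  intro x hx
  rw [facet_eq, body_eq]
  refine ⟨fun k => ?_, hx.1⟩
  by_cases h : k = i
  · rw [h, hx.1]
  · exact (hx.2 k h).le

theorem measurableSet_openFacet (i : Fin (d + 1)) : MeasurableSet (openFacet T i) := by
  have : openFacet T i = {x | (vertexBasis T).coord i x = 0} ∩
      ⋂ k, ⋂ (_ : k ≠ i), {x | 0 < (vertexBasis T).coord k x} := by
    ext x; simp [openFacet]
  rw [this]
  refine (isClosed_singleton.preimage (continuous_coord T i)).measurableSet.inter
    (MeasurableSet.iInter fun k => MeasurableSet.iInter fun _ => ?_)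
  exact (isOpen_Ioi.preimage (continuous_coord T k)).measurableSet

theorem facet_subset_frontier (i : Fin (d + 1)) : facet T i ⊆ frontier (body T) := by
  intro x hx
  rw [facet_eq] at hx
  rw [(isCompact_body T).isClosed.frontier_eq]
  refine ⟨hx.1, fun h => ?_⟩
  rw [interior_body_eq] at h
  exact (h i).ne' hx.2

theorem nonempty_facet [NeZero d] (i : Fin (d + 1)) : (facet T i).Nonempty := by
  obtain ⟨k, hk⟩ := exists_ne i
  exact ⟨T.points k, subset_convexHull ℝ _ ⟨k, hk, rfl⟩⟩

theorem disjoint_openFacet {i k : Fin (d + 1)} (hik : i ≠ k) :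
    Disjoint (openFacet T i) (openFacet T k) :=
  Set.disjoint_left.2 fun _ hi hk => (hk.2 i hik).ne' hi.1

theorem nonempty_interior_body : (interior (body T)).Nonempty := by
  have := interior_convexHull_nonempty_iff_affineSpan_eq_top (s := range T.points)
  exact this.2 (vertexBasis T).tot

end Simplex

/-- Every facet of a simplex admits an isometric parametrization by `ℝⁿ` which extends to conical
coordinates with apex the opposite vertex. -/
theorem exists_facetChart (T : Affine.Simplex ℝ (E (n + 1)) (n + 1)) (i : Fin (n + 1 + 1)) :
    ∃ e : (ℝ × E n) ≃L[ℝ] E (n + 1),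
      Isometry (fun y => T.points i + e (1, y)) ∧
      (∀ z, (vertexBasis T).coord i (T.points i + e z) = 1 - z.1) ∧
      ∀ k, k ≠ i → ∀ z, (vertexBasis T).coord k (cone (T.points i) e z)
        = z.1 * (vertexBasis T).coord k (T.points i + e (1, z.2)) := by
  obtain ⟨i₀, hi₀⟩ : ∃ i₀, i₀ ≠ i := exists_ne i
  set b := vertexBasis T with hb
  set a := T.points i with ha
  set L : E (n + 1) →ₗ[ℝ] ℝ := (b.coord i).linear with hL
  set u : E (n + 1) := T.points i₀ - a with hu
  have hcoord : ∀ k x, b.coord k (a + x) = b.coord k a + (b.coord k).linear x := by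
    intro k x
    have := (b.coord k).map_vadd a x
    rw [vadd_eq_add, vadd_eq_add] at this
    rw [add_comm a x, this, add_comm]
  have hLu : L u = -1 := by
    have h1 := hcoord i u
    rw [hu, add_sub_cancel, hb, coord_vertex, coord_vertex, if_neg hi₀.symm, if_pos rfl] at h1
    change 0 = 1 + L u at h1
    linarith
  have hLr : Module.finrank ℝ (LinearMap.ker L) = n := by
    have hsurj : Function.Surjective L := fun c => ⟨(-c) • u, by rw [map_smul, hLu]; simp⟩
    have h1 := L.finrank_range_add_finrank_ker
    rw [LinearMap.range_eq_top.2 hsurj, finrank_top, Module.finrank_self,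
      finrank_euclideanSpace_fin] at h1
    omega
  let ι : E n ≃ₗᵢ[ℝ] LinearMap.ker L :=
    (((stdOrthonormalBasis ℝ (LinearMap.ker L)).reindex (finCongr hLr)).repr).symm
  let f : (ℝ × E n) →ₗ[ℝ] E (n + 1) :=
    (LinearMap.toSpanSingleton ℝ _ u).coprod ((LinearMap.ker L).subtype ∘ₗ ι.toLinearEquiv)
  have hf : ∀ z, f z = z.1 • u + (ι z.2 : E (n + 1)) := fun z => rfl
  have hLf : ∀ z, L (f z) = -z.1 := by
    intro z
    have h1 : L (ι z.2 : E (n + 1)) = 0 := (ι z.2).2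
    rw [hf, map_add, map_smul, hLu, h1]; simp
  have hinj : Function.Injective f := by
    rw [← LinearMap.ker_eq_bot, LinearMap.ker_eq_bot']
    intro z hz
    have h1 : z.1 = 0 := by have := hLf z; rw [hz, map_zero] at this; linarith
    have h2 := hf z
    rw [hz, h1, zero_smul, zero_add] at h2
    have h3 : z.2 = 0 := by
      apply ι.injective
      rw [map_zero]
      exact Subtype.ext h2.symm
    exact Prod.ext h1 h3
  have hrank : Module.finrank ℝ (ℝ × E n) = Module.finrank ℝ (E (n + 1)) := by
    simp [Module.finrank_prod, add_comm]
  let e : (ℝ × E n) ≃L[ℝ] E (n + 1) :=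
    (LinearEquiv.ofInjectiveOfFinrankEq f hinj hrank).toContinuousLinearEquiv
  have he : ∀ z, e z = f z := fun z => rfl
  refine ⟨e, ?_, ?_, ?_⟩
  · refine Isometry.of_dist_eq fun y y' => ?_
    rw [dist_add_left, he, he, hf, hf, dist_add_left]
    simp only
    rw [← Subtype.dist_eq, ι.dist_map]
  · intro z
    rw [hcoord, hb, coord_vertex, if_pos rfl]
    change 1 + L (e _) = _
    rw [he, hLf]; ring
  · intro k hk z
    have h0 : b.coord k a = 0 := by rw [hb, ha, coord_vertex, if_neg hk]
    have h1 : cone a e z = a + z.1 • e (1, z.2) := by rw [← cone_sub]; abel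
    rw [h1, hcoord, hcoord, h0, map_smul, smul_eq_mul]; ring

/-- Points of the hyperplane of the facet are in the range of its parametrization. -/
theorem exists_eq_of_coord_eq_zero {T : Affine.Simplex ℝ (E (n + 1)) (n + 1)}
    {i : Fin (n + 1 + 1)} {e : (ℝ × E n) ≃L[ℝ] E (n + 1)}
    (he : ∀ z, (vertexBasis T).coord i (T.points i + e z) = 1 - z.1) {x : E (n + 1)}
    (hx : (vertexBasis T).coord i x = 0) : ∃ y, T.points i + e (1, y) = x := by
  have hxe : T.points i + e (e.symm (x - T.points i)) = x := by
    rw [ContinuousLinearEquiv.apply_symm_apply]; abel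
  have h1 := he (e.symm (x - T.points i))
  rw [hxe, hx] at h1
  refine ⟨(e.symm (x - T.points i)).2, ?_⟩
  have h2 : ((1 : ℝ), (e.symm (x - T.points i)).2) = e.symm (x - T.points i) :=
    Prod.ext (by linarith) rfl
  rw [h2, hxe]

/-- Two distinct facets of a simplex meet in a set of zero `n`-dimensional measure. -/
theorem area_coord_eq_zero (T : Affine.Simplex ℝ (E (n + 1)) (n + 1)) {i k : Fin (n + 1 + 1)}
    (hik : i ≠ k) : area (n + 1)
      {x | (vertexBasis T).coord i x = 0 ∧ (vertexBasis T).coord k x = 0} = 0 := by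
  obtain ⟨e, hiso, hci, hck⟩ := exists_facetChart T i
  set a := T.points i with ha
  set b := vertexBasis T with hb
  let j : E n →ᵃ[ℝ] E (n + 1) :=
    ((e : (ℝ × E n) →ₗ[ℝ] E (n + 1)) ∘ₗ LinearMap.inr ℝ ℝ (E n)).toAffineMap
      + AffineMap.const ℝ (E n) (a + e (1, 0))
  have hj : ∀ y, j y = a + e (1, y) := by
    intro y
    have h1 : ((1 : ℝ), y) = (0, y) + (1, 0) := by simp
    change e (0, y) + (a + e (1, 0)) = _
    rw [h1, map_add]; abel
  have hsurj : ∀ x, b.coord i x = 0 → ∃ y, a + e (1, y) = x :=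
    fun x => exists_eq_of_coord_eq_zero hci
  have hsub : {x | b.coord i x = 0 ∧ b.coord k x = 0}
      = (fun y => a + e (1, y)) '' {y | b.coord k (a + e (1, y)) = 0} := by
    ext x
    constructor
    · rintro ⟨h1, h2⟩
      obtain ⟨y, rfl⟩ := hsurj x h1
      exact ⟨y, h2, rfl⟩
    · rintro ⟨y, hy, rfl⟩
      have h1 := hci (1, y)
      exact ⟨by rw [h1]; simp, hy⟩
  rw [hsub, area, hiso.euclideanHausdorffMeasure_image]
  change (Measure.euclideanHausdorffMeasure n : Measure (E n)) _ = 0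
  rw [EuclideanSpace.euclideanHausdorffMeasure_eq_volume]
  set S : AffineSubspace ℝ (E n) := (AffineSubspace.mk' (0 : ℝ) ⊥).comap ((b.coord k).comp j)
  have hS : (S : Set (E n)) = {y | b.coord k (a + e (1, y)) = 0} := by
    ext y
    simp [S, AffineSubspace.mem_mk', hj]
  rw [← hS]
  refine Measure.addHaar_affineSubspace _ S fun htop => ?_
  obtain ⟨y, hy⟩ := hsurj (T.points k) (by rw [hb, coord_vertex, if_neg hik])
  have : y ∈ (S : Set (E n)) := by rw [htop]; trivial
  rw [hS, mem_ofPred_eq, hy, hb, coord_vertex, if_pos rfl] at this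
  exact one_ne_zero this

end

/-! ### The trace on a facet; boundary points of a partition -/

section

variable {n : ℕ}

/-- The trace of `v` on a facet of the simplex `T`, the sharp trace inequality on this facet, and
the Lebesgue point property relative to `T`. The factor `coneFactor` of the chart disappears since
it also relates the volume of `T` to the area of the facet. -/
theorem exists_facetTrace (T : Affine.Simplex ℝ (E (n + 1)) (n + 1)) (i : Fin (n + 1 + 1))
    {K : Set (E (n + 1))} {v : E (n + 1) → ℝ} {g : E (n + 1) → E (n + 1)}
    (h : IsWeakGradient K v g) (hvm : Measurable v) (hgm : Measurable g)
    (hv : IntegrableOn v (interior K)) (hg : IntegrableOn g (interior K))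
    (hT : interior (body T) ⊆ interior K) {D : ℝ} (hD : ∀ x ∈ body T, ‖x - T.points i‖ ≤ D) :
    ∃ W : E (n + 1) → ℝ, Measurable W ∧
      (∀ p : ℝ, 1 ≤ p → ((n + 1 : ℕ) : ℝ≥0∞) * volume (body T) *
          ∫⁻ x in openFacet T i, ENNReal.ofReal (|W x| ^ p) ∂(area (n + 1)) ≤
        area (n + 1) (openFacet T i) * ∫⁻ x in interior (body T),
          ENNReal.ofReal ((n + 1) * |v x| ^ p + p * |v x| ^ (p - 1) * (D * ‖g x‖))) ∧
      ∀ᵐ x ∂((area (n + 1)).restrict (openFacet T i)), Tendsto (fun r : ℝ =>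
        (∫⁻ y in interior (body T) ∩ Metric.ball x r, ‖v y - W x‖ₑ)
          / ENNReal.ofReal (r ^ (n + 1))) (𝓝[>] 0) (𝓝 0) := by
  obtain ⟨e, hiso, hci, hck⟩ := exists_facetChart T i
  set a := T.points i with ha
  set b := vertexBasis T with hb
  set j : E n → E (n + 1) := fun y => a + e (1, y) with hj
  have hjc : Continuous j := hiso.continuous
  have hjm : MeasurableEmbedding j := hiso.isClosedEmbedding.measurableEmbedding
  have hcij : ∀ y, b.coord i (j y) = 0 := fun y => by
    have := hci (1, y); simpa using this
  set Ω : Set (E n) := {y | ∀ k, k ≠ i → 0 < b.coord k (j y)} with hΩdef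
  have hΩ : IsOpen Ω := by
    have : Ω = ⋂ k, ⋂ (_ : k ≠ i), {y | 0 < b.coord k (j y)} := by ext y; simp [hΩdef]
    rw [this]
    exact isOpen_iInter_of_finite fun k => isOpen_iInter_of_finite fun _ =>
      isOpen_Ioi.preimage ((continuous_coord T k).comp hjc)
  have hfacet : openFacet T i = j '' Ω := by
    ext x
    constructor
    · rintro ⟨h1, h2⟩
      obtain ⟨y, rfl⟩ := exists_eq_of_coord_eq_zero hci h1
      exact ⟨y, h2, rfl⟩
    · rintro ⟨y, hy, rfl⟩
      exact ⟨hcij y, hy⟩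
  have hcone : coneSet a e Ω = interior (body T) := by
    rw [interior_body_eq]
    ext x
    constructor
    · intro hx
      obtain ⟨z, hz, rfl⟩ := exists_cone_eq hx
      intro k
      by_cases hk : k = i
      · rw [hk, cone, hci]; linarith [hz.1.2]
      · rw [hck k hk z]; exact mul_pos hz.1.1 (hz.2 k hk)
    · intro hx
      have hxe : a + e (e.symm (x - a)) = x := by
        rw [ContinuousLinearEquiv.apply_symm_apply]; abel
      have h1 := hci (e.symm (x - a))
      rw [hxe] at h1
      obtain ⟨i₀, hi₀⟩ : ∃ i₀, i₀ ≠ i := exists_ne i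
      have h2 : b.coord i x < 1 := by
        rw [← b.sum_coord_apply_eq_one x]
        exact Finset.single_lt_sum hi₀ (Finset.mem_univ _) (Finset.mem_univ _) (hx i₀)
          fun k _ _ => (hx k).le
      have h3 := hx i
      change 0 < b.coord i x at h3
      set t := (e.symm (x - a)).1 with ht
      have ht0 : 0 < t := by linarith
      refine ⟨⟨ht0, by linarith⟩, fun k hk => ?_⟩
      have h4 := hck k hk (t, t⁻¹ • (e.symm (x - a)).2)
      have h5 : cone a e (t, t⁻¹ • (e.symm (x - a)).2) = x := by
        simp only [cone, smul_smul, mul_inv_cancel₀ ht0.ne', one_smul]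
        exact hxe
      rw [h5] at h4
      have h6 : 0 < b.coord k x := hx k
      rw [h4] at h6
      exact (pos_iff_pos_of_mul_pos h6).1 ht0
  have hmap : (area (n + 1)).restrict (openFacet T i) = (volume.restrict Ω).map j := by
    ext s hs
    rw [Measure.restrict_apply hs, Measure.map_apply hjc.measurable hs,
      Measure.restrict_apply (hjc.measurable hs), hfacet, inter_comm s, ← image_inter_preimage,
      area, hiso.euclideanHausdorffMeasure_image]
    change (Measure.euclideanHausdorffMeasure n : Measure (E n)) _ = _
    rw [EuclideanSpace.euclideanHausdorffMeasure_eq_volume, inter_comm]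
  have harea : area (n + 1) (openFacet T i) = volume Ω := by
    have h1 := congrArg (fun μ : Measure (E (n + 1)) => μ univ) hmap
    simpa [Measure.map_apply hjc.measurable MeasurableSet.univ] using h1
  have hDΩ : ∀ y ∈ Ω, ‖e (1, y)‖ ≤ D := by
    intro y hy
    have h1 : j y ∈ openFacet T i := hfacet ▸ mem_image_of_mem j hy
    have h2 : j y ∈ body T := (facet_eq T i ▸ openFacet_subset_facet T i h1).1
    have h3 := hD _ h2
    rwa [hj, add_sub_cancel_left] at h3
  have hCK : coneSet a e Ω ⊆ interior K := hcone ▸ hT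
  obtain ⟨w, hwm, hwp, hwae⟩ := exists_coneTrace h hvm hgm hv hg hΩ hCK hDΩ
  have hwi : IntegrableOn w Ω := by
    refine ⟨hwm.aestronglyMeasurable, ?_⟩
    have h1 := hwp 1 le_rfl
    simp only [Real.rpow_one, sub_self, Real.rpow_zero, mul_one, one_mul] at h1
    have h2 : ∫⁻ x in coneSet a e Ω, ENNReal.ofReal ((n + 1) * |v x| + D * ‖g x‖) < ⊤ := by
      have h3 : Integrable (fun x => ((n : ℝ) + 1) * |v x| + D * ‖g x‖)
          (volume.restrict (coneSet a e Ω)) :=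
        ((hv.mono_set hCK).abs.const_mul _).add ((hg.mono_set hCK).norm.const_mul _)
      exact h3.lintegral_lt_top
    have h4 := (ENNReal.mul_lt_top_iff.1 (h1.trans_lt h2))
    have h5 : ∫⁻ y in Ω, ENNReal.ofReal |w y| < ⊤ :=
      h4.elim (fun h => h.2) (fun h => h.elim
        (fun h => absurd h (by simpa using (coneFactor_pos e).ne')) (fun h => by simp [h]))
    simpa [HasFiniteIntegral, ← ofReal_norm, Real.norm_eq_abs] using h5
  have hleb := ae_tendsto_lintegral_coneSet hvm hgm hΩ (hg.mono_set hCK) hDΩ hwm hwi hwae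
  -- extend `w` to the whole space through the chart
  set W : E (n + 1) → ℝ := fun x => w (e.symm (x - a)).2 with hW
  have hWm : Measurable W := hwm.comp (Continuous.measurable (by fun_prop))
  have hWj : ∀ y, W (j y) = w y := fun y => by simp [hW, hj]
  refine ⟨W, hWm, fun p hp => ?_, ?_⟩
  · have h1 : volume (body T) = volume (coneSet a e Ω) := by
      rw [hcone]
      exact (measure_eq_measure_of_null_sdiff interior_subset
        (measure_mono_null (sdiff_subset_sdiff_left subset_closure)
          ((convex_body T).addHaar_frontier volume))).symm
    have h2 : ∫⁻ x in openFacet T i, ENNReal.ofReal (|W x| ^ p) ∂(area (n + 1))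
        = ∫⁻ y in Ω, ENNReal.ofReal (|w y| ^ p) := by
      rw [hmap, lintegral_map (by fun_prop) hjc.measurable]
      simp only [hWj]
    rw [h1, h2, volume_coneSet a e hΩ, harea, ← hcone, mul_comm (coneFactor e : ℝ≥0∞), mul_assoc]
    exact mul_le_mul_right (hwp p hp) _
  · rw [hmap, hjm.ae_map_iff]
    simp only [hWj, ← hcone]
    exact hleb

/-- A simplex has positive lower density at each of its points. -/
theorem exists_le_volume_body_inter_ball {d : ℕ} (T : Affine.Simplex ℝ (E d) d) {x : E d}
    (hx : x ∈ body T) : ∃ κ : ℝ≥0∞, κ ≠ 0 ∧ ∀ᶠ r : ℝ in 𝓝[>] 0,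
      κ * ENNReal.ofReal (r ^ d) ≤ volume (body T ∩ Metric.ball x r) := by
  set R := Metric.diam (body T) + 1 with hR
  have hR0 : 0 < R := by positivity
  have hlt : ∀ y ∈ body T, dist y x < R := fun y hy =>
    (Metric.dist_le_diam_of_mem (isCompact_body T).isBounded hy hx).trans_lt (by linarith)
  refine ⟨ENNReal.ofReal ((R⁻¹) ^ d) * volume (body T), mul_ne_zero ?_ ?_, ?_⟩
  · have : 0 < (R⁻¹) ^ d := by positivity
    simpa using this
  · exact (Measure.measure_pos_of_nonempty_interior _ (nonempty_interior_body T)).ne'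
  · filter_upwards [Ioo_mem_nhdsGT hR0] with r hr
    have hs0 : 0 < r / R := div_pos hr.1 hR0
    have hs1 : r / R ≤ 1 := (div_le_one hR0).2 hr.2.le
    have hsub : AffineMap.homothety x (r / R) '' body T ⊆ body T ∩ Metric.ball x r := by
      rintro _ ⟨y, hy, rfl⟩
      constructor
      · rw [AffineMap.homothety_eq_lineMap]
        exact (convex_body T).segment_subset hx hy
          (by rw [segment_eq_image_lineMap]; exact ⟨r / R, ⟨hs0.le, hs1⟩, rfl⟩)
      · rw [Metric.mem_ball, dist_homothety_center, Real.norm_of_nonneg hs0.le]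
        calc r / R * dist x y < r / R * R := by
              rw [dist_comm]; exact mul_lt_mul_of_pos_left (hlt y hy) hs0
          _ = r := div_mul_cancel₀ r hR0.ne'
    refine le_trans (le_of_eq ?_) (measure_mono hsub)
    rw [Measure.addHaar_image_homothety, finrank_euclideanSpace_fin,
      abs_of_nonneg (by positivity), div_eq_mul_inv, mul_pow, mul_right_comm,
      ← ENNReal.ofReal_mul (by positivity), mul_comm (r ^ d)]

section Partition

variable {d : ℕ} {γ : ℝ} {K : Set (E d)} {𝔗 : Finset (Affine.Simplex ℝ (E d) d)}

theorem IsRegularPartition.body_subset (h : IsRegularPartition γ K 𝔗) {T} (hT : T ∈ 𝔗) :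
    body T ⊆ K := h.iUnion_eq ▸ subset_biUnion_of_mem (u := fun T => body T) hT

theorem IsRegularPartition.isCompact (h : IsRegularPartition γ K 𝔗) : IsCompact K :=
  h.iUnion_eq ▸ 𝔗.finite_toSet.isCompact_biUnion fun T _ => isCompact_body T

theorem IsRegularPartition.exists_mem_body (h : IsRegularPartition γ K 𝔗) {x} (hx : x ∈ K) :
    ∃ T ∈ 𝔗, x ∈ body T := by
  rw [← h.iUnion_eq] at hx
  simpa using hx

/-- A boundary point of `K` lying on at most one facet of `T` is in the relative interior of a
facet of `T`. -/
theorem IsRegularPartition.exists_mem_openFacet (h : IsRegularPartition γ K 𝔗) {T} (hT : T ∈ 𝔗)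
    {x : E d} (hx : x ∈ frontier K) (hxT : x ∈ body T)
    (hN : ∀ i k, i ≠ k → ¬((vertexBasis T).coord i x = 0 ∧ (vertexBasis T).coord k x = 0)) :
    ∃ i, x ∈ openFacet T i := by
  have h1 : x ∉ interior (body T) := fun h' => hx.2 (interior_mono (h.body_subset hT) h')
  rw [interior_body_eq, mem_ofPred_eq, not_forall] at h1
  rw [body_eq] at hxT
  obtain ⟨i, hi⟩ := h1
  have h0 : (vertexBasis T).coord i x = 0 := le_antisymm (not_lt.1 hi) (hxT i)
  exact ⟨i, h0, fun k hk => lt_of_le_of_ne (hxT k) fun h' => hN i k hk.symm ⟨h0, h'.symm⟩⟩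

/-- Two simplices of the partition never meet at boundary points of `K` in the relative interiors
of facets: near such a point both are half-balls, hence complementary half-balls as they do not
overlap, and the point would be interior to `K`. -/
theorem IsRegularPartition.eq_of_mem_openFacet (h : IsRegularPartition γ K 𝔗) {T T'}
    (hT : T ∈ 𝔗) (hT' : T' ∈ 𝔗) {x : E d} (hx : x ∈ frontier K) {i i'}
    (hi : x ∈ openFacet T i) (hi' : x ∈ openFacet T' i') : T = T' := by
  by_contra hne
  have hdisj := h.disjoint T hT T' hT' hne
  have hnear : ∀ (S : Affine.Simplex ℝ (E d) d) (k : Fin (d + 1)), x ∈ openFacet S k →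
      ∀ᶠ y in 𝓝 x, ∀ l, l ≠ k → 0 < (vertexBasis S).coord l y := by
    intro S k hS
    refine eventually_all.2 fun l => ?_
    by_cases hl : l = k
    · simp [hl]
    · filter_upwards [(continuous_coord S l).continuousAt.eventually (lt_mem_nhds (hS.2 l hl))]
        with y hy _ using hy
  have hlin : ∀ (S : Affine.Simplex ℝ (E d) d) (k : Fin (d + 1)), x ∈ openFacet S k →
      ∀ u, (vertexBasis S).coord k (x + u) = ((vertexBasis S).coord k).linear u := by
    intro S k hS u
    have := ((vertexBasis S).coord k).map_vadd x u
    rw [vadd_eq_add, vadd_eq_add, hS.1, add_zero] at this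
    rw [add_comm x u, this]
  set L := ((vertexBasis T).coord i).linear
  set L' := ((vertexBasis T').coord i').linear
  have hU := (hnear T i hi).and (hnear T' i' hi')
  have hopp : ∀ u, 0 < L u → 0 < L' u → False := by
    intro u hu hu'
    have hc : Tendsto (fun s : ℝ => x + s • u) (𝓝[>] 0) (𝓝 x) := by
      have : Continuous fun s : ℝ => x + s • u := by fun_prop
      exact tendsto_nhdsWithin_of_tendsto_nhds (by simpa using this.tendsto 0)
    obtain ⟨s, hs, hs0⟩ := ((hc.eventually hU).and self_mem_nhdsWithin).exists
    have hs0' : 0 < s := hs0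
    refine Set.disjoint_left.1 hdisj (?_ : x + s • u ∈ _) ?_
    · rw [interior_body_eq]
      intro l
      by_cases hl : l = i
      · rw [hl, hlin T i hi, map_smul]; exact mul_pos hs0' hu
      · exact hs.1 l hl
    · rw [interior_body_eq]
      intro l
      by_cases hl : l = i'
      · rw [hl, hlin T' i' hi', map_smul]; exact mul_pos hs0' hu'
      · exact hs.2 l hl
  refine hx.2 (mem_interior_iff_mem_nhds.2 ?_)
  filter_upwards [hU] with y hy
  obtain ⟨u, rfl⟩ : ∃ u, x + u = y := ⟨y - x, by abel⟩
  by_cases h1 : 0 ≤ L u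
  · refine h.body_subset hT ?_
    rw [body_eq]
    intro l
    by_cases hl : l = i
    · rw [hl, hlin T i hi]; exact h1
    · exact (hy.1 l hl).le
  · refine h.body_subset hT' ?_
    have h2 : 0 ≤ L' u := by
      by_contra h2
      exact hopp (-u) (by rw [map_neg]; linarith) (by rw [map_neg]; linarith)
    rw [body_eq]
    intro l
    by_cases hl : l = i'
    · rw [hl, hlin T' i' hi']; exact h2
    · exact (hy.2 l hl).le

/-- Near a point which belongs to only one simplex `T` of the partition, `K` coincides with `T`. -/
theorem IsRegularPartition.eventually_inter_ball_eq (h : IsRegularPartition γ K 𝔗) {T}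
    (hT : T ∈ 𝔗) {x : E d} (hx : ∀ T' ∈ 𝔗, x ∈ body T' → T = T') :
    ∀ᶠ r : ℝ in 𝓝[>] 0, K ∩ Metric.ball x r = body T ∩ Metric.ball x r := by
  have h1 : ∀ᶠ y in 𝓝 x, ∀ T' ∈ 𝔗, y ∈ body T' → T = T' := by
    refine (Finset.eventually_all 𝔗).2 fun T' hT' => ?_
    by_cases hxT' : x ∈ body T'
    · exact Eventually.of_forall fun y _ => hx T' hT' hxT'
    · filter_upwards [(isCompact_body T').isClosed.isOpen_compl.mem_nhds hxT'] with y hy h'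
        using absurd h' hy
  obtain ⟨ε, hε, hball⟩ := Metric.eventually_nhds_iff_ball.1 h1
  filter_upwards [Ioo_mem_nhdsGT hε] with r hr
  refine Subset.antisymm (fun y hy => ⟨?_, hy.2⟩) (inter_subset_inter_left _ (h.body_subset hT))
  obtain ⟨T', hT', hyT'⟩ := h.exists_mem_body hy.1
  rwa [hball y (Metric.ball_subset_ball hr.2.le hy.2) T' hT' hyT']

end Partition

/-- Almost every boundary point of `K` lies in the relative interior of exactly one facet of
exactly one simplex of the partition, and this facet is contained in the boundary of `K`. -/
theorem IsRegularPartition.ae_existsUnique {γ : ℝ} {K : Set (E (n + 1))}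
    {𝔗 : Finset (Affine.Simplex ℝ (E (n + 1)) (n + 1))} (h : IsRegularPartition γ K 𝔗) :
    ∀ᵐ x ∂(surface K), x ∈ frontier K ∧ ∃ T ∈ 𝔗, ∃ i, facet T i ⊆ frontier K ∧ x ∈ openFacet T i ∧
      ∀ T' ∈ 𝔗, x ∈ body T' → T = T' := by
  have h1 : ∀ᵐ x ∂(area (n + 1)), ∀ T ∈ 𝔗, ∀ i k, i ≠ k →
      ¬((vertexBasis T).coord i x = 0 ∧ (vertexBasis T).coord k x = 0) := by
    refine (Finset.eventually_all 𝔗).2 fun T _ => eventually_all.2 fun i => eventually_all.2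
      fun k => ?_
    by_cases hik : i = k
    · simp [hik]
    · have := measure_eq_zero_iff_ae_notMem.1 (area_coord_eq_zero T hik)
      filter_upwards [this] with x hx _ using hx
  have h2 : ∀ᵐ x ∂(area (n + 1)), ∀ T ∈ 𝔗, ∀ i, x ∈ facet T i ∩ frontier K →
      facet T i ⊆ frontier K := by
    refine (Finset.eventually_all 𝔗).2 fun T hT => eventually_all.2 fun i => ?_
    rcases h.facets T hT i with h3 | h3
    · exact Eventually.of_forall fun _ _ => h3
    · filter_upwards [measure_eq_zero_iff_ae_notMem.1 h3] with x hx h' using absurd h' hx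
  have h3 : ∀ᵐ x ∂(surface K), x ∈ frontier K :=
    ae_restrict_mem isClosed_frontier.measurableSet
  filter_upwards [h3, ae_restrict_of_ae h1, ae_restrict_of_ae h2] with x hx hx1 hx2
  obtain ⟨T, hT, hxT⟩ := h.exists_mem_body (h.isCompact.isClosed.frontier_subset hx)
  obtain ⟨i, hi⟩ := h.exists_mem_openFacet hT hx hxT (hx1 T hT)
  refine ⟨hx, T, hT, i, hx2 T hT i ⟨openFacet_subset_facet T i hi, hx⟩, hi, fun T' hT' hxT' => ?_⟩
  obtain ⟨i', hi'⟩ := h.exists_mem_openFacet hT' hx hxT' (hx1 T' hT')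
  exact h.eq_of_mem_openFacet hT hT' hx hi hi'

end

/-! ### The trace on the boundary of an element -/

section

variable {n : ℕ}

theorem setAverage_abs_sub_eq_toReal {d : ℕ} {v : E d → ℝ} (hvm : Measurable v) (c : ℝ)
    (S : Set (E d)) :
    ⨍ y in S, |v y - c| = ((∫⁻ y in S, ‖v y - c‖ₑ) / volume S).toReal := by
  rw [← setLAverage_eq, toReal_laverage (by fun_prop) (by simp)]
  simp

/-- Existence of the trace on the boundary of a regular element, with the fundamental estimate from
which both trace inequalities follow. -/
theorem IsRegularPartition.exists_trace {γ : ℝ} {K : Set (E (n + 1))}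
    {𝔗 : Finset (Affine.Simplex ℝ (E (n + 1)) (n + 1))} (h : IsRegularPartition γ K 𝔗)
    {v : E (n + 1) → ℝ} {g : E (n + 1) → E (n + 1)} (hvm : Measurable v) (hgm : Measurable g)
    (hv : IntegrableOn v K) (hg : IntegrableOn g K) (hw : IsWeakGradient K v g) :
    ∃ W : E (n + 1) → ℝ, Measurable W ∧ IsTrace K v W ∧ ∀ p : ℝ, 1 ≤ p →
      ENNReal.ofReal (γ * Metric.diam K) * ∫⁻ x, ENNReal.ofReal (|W x| ^ p) ∂(surface K) ≤
        ∫⁻ x in K, ENNReal.ofReal (((n + 1 : ℕ) : ℝ) * |v x| ^ p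
          + p * |v x| ^ (p - 1) * (Metric.diam K * ‖g x‖)) := by
  classical
  have hKb : Bornology.IsBounded K := h.isCompact.isBounded
  have hfac : ∀ T i, T ∈ 𝔗 → ∃ W : E (n + 1) → ℝ, Measurable W ∧
      (∀ p : ℝ, 1 ≤ p → ((n + 1 : ℕ) : ℝ≥0∞) * volume (body T) *
          ∫⁻ x in openFacet T i, ENNReal.ofReal (|W x| ^ p) ∂(area (n + 1)) ≤
        area (n + 1) (openFacet T i) * ∫⁻ x in interior (body T),
          ENNReal.ofReal ((n + 1) * |v x| ^ p + p * |v x| ^ (p - 1) * (Metric.diam K * ‖g x‖))) ∧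
      ∀ᵐ x ∂((area (n + 1)).restrict (openFacet T i)), Tendsto (fun r : ℝ =>
        (∫⁻ y in interior (body T) ∩ Metric.ball x r, ‖v y - W x‖ₑ)
          / ENNReal.ofReal (r ^ (n + 1))) (𝓝[>] 0) (𝓝 0) := fun T i hT =>
    exists_facetTrace T i hw hvm hgm (hv.mono_set interior_subset) (hg.mono_set interior_subset)
      (interior_mono (h.body_subset hT)) fun x hx => by
        rw [← dist_eq_norm]
        exact Metric.dist_le_diam_of_mem hKb (h.body_subset hT hx)
          (h.body_subset hT (subset_convexHull ℝ _ (mem_range_self i)))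
  choose! Wf hWm hWp hWl using hfac
  -- the facets of `T` which make up the part of `∂T` on the boundary of `K`
  set I : Affine.Simplex ℝ (E (n + 1)) (n + 1) → Finset (Fin (n + 1 + 1)) :=
    fun T => Finset.univ.filter fun i => facet T i ⊆ frontier K with hI
  set W : E (n + 1) → ℝ := fun x => ∑ T ∈ 𝔗, ∑ i ∈ I T, (openFacet T i).indicator (Wf T i) x
    with hW
  have hWmeas : Measurable W := Finset.measurable_fun_sum _ fun T hT =>
    Finset.measurable_fun_sum _ fun i _ => (hWm T i hT).indicator (measurableSet_openFacet T i)
  have hWeq : ∀ x, ∀ T ∈ 𝔗, ∀ i, facet T i ⊆ frontier K → x ∈ openFacet T i →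
      (∀ T' ∈ 𝔗, x ∈ body T' → T = T') → W x = Wf T i x := by
    intro x T hT i hi hx huniq
    have hbody : ∀ T' i', x ∈ openFacet T' i' → x ∈ body T' := fun T' i' hx' =>
      (facet_eq T' i' ▸ openFacet_subset_facet T' i' hx').1
    simp only [hW]
    rw [Finset.sum_eq_single_of_mem T hT, Finset.sum_eq_single_of_mem i (by simp [hI, hi]),
      indicator_of_mem hx]
    · intro k _ hk
      exact indicator_of_notMem (Set.disjoint_left.1 (disjoint_openFacet T hk.symm) hx) _
    · intro T' hT' hne
      exact Finset.sum_eq_zero fun i' _ => indicator_of_notMem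
        (fun hx' => hne (huniq T' hT' (hbody T' i' hx')).symm) _
  refine ⟨W, hWmeas, ?_, fun p hp => ?_⟩
  · have hl : ∀ᵐ x ∂(surface K), ∀ T ∈ 𝔗, ∀ i, x ∈ openFacet T i → Tendsto (fun r : ℝ =>
        (∫⁻ y in interior (body T) ∩ Metric.ball x r, ‖v y - Wf T i x‖ₑ)
          / ENNReal.ofReal (r ^ (n + 1))) (𝓝[>] 0) (𝓝 0) := by
      refine ae_restrict_of_ae ((Finset.eventually_all 𝔗).2 fun T hT => eventually_all.2
        fun i => ?_)
      exact (ae_restrict_iff' (measurableSet_openFacet T i)).1 (hWl T i hT)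
    filter_upwards [h.ae_existsUnique, hl] with x hx hlx
    obtain ⟨hxK, T, hT, i, hiK, hi, huniq⟩ := hx
    rw [hWeq x T hT i hiK hi huniq]
    simp only [setAverage_abs_sub_eq_toReal hvm]
    rw [← ENNReal.toReal_zero]
    refine (ENNReal.tendsto_toReal ENNReal.zero_ne_top).comp ?_
    have hxT : x ∈ body T := (facet_eq T i ▸ openFacet_subset_facet T i hi).1
    obtain ⟨κ, hκ, hκv⟩ := exists_le_volume_body_inter_ball T hxT
    have hlim := ENNReal.Tendsto.const_mul (a := κ⁻¹) (hlx T hT i hi)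
      (Or.inr (ENNReal.inv_ne_top.2 hκ))
    rw [mul_zero] at hlim
    refine tendsto_of_tendsto_of_tendsto_of_le_of_le' tendsto_const_nhds hlim
      (Eventually.of_forall fun _ => zero_le) ?_
    filter_upwards [hκv, h.eventually_inter_ball_eq hT huniq, self_mem_nhdsWithin]
      with r hr1 hr2 hr3
    have hr0 : (0 : ℝ) < r := hr3
    rw [hr2]
    have hnull : (body T ∩ Metric.ball x r : Set _) =ᵐ[volume]
        (interior (body T) ∩ Metric.ball x r : Set _) := by
      refine ae_eq_set_inter ?_ (ae_eq_refl _)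
      exact (interior_ae_eq_of_null_frontier ((convex_body T).addHaar_frontier volume)).symm
    rw [setLIntegral_congr hnull]
    have hρ : ENNReal.ofReal (r ^ (n + 1)) ≠ 0 := by
      have := pow_pos hr0 (n + 1); simpa using this
    calc _ ≤ (∫⁻ y in interior (body T) ∩ Metric.ball x r, ‖v y - Wf T i x‖ₑ)
          / (κ * ENNReal.ofReal (r ^ (n + 1))) := ENNReal.div_le_div_left hr1 _
      _ = _ := by
        rw [div_eq_mul_inv, ENNReal.mul_inv (Or.inl hκ) (Or.inr hρ), div_eq_mul_inv]; ring
  · set R : E (n + 1) → ℝ≥0∞ := fun x => ENNReal.ofReal (((n + 1 : ℕ) : ℝ) * |v x| ^ p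
          + p * |v x| ^ (p - 1) * (Metric.diam K * ‖g x‖)) with hR
    have hRm : Measurable R := by fun_prop
    -- the boundary integral splits over the facets on the boundary
    have hsplit : ∫⁻ x, ENNReal.ofReal (|W x| ^ p) ∂(surface K) ≤
        ∑ T ∈ 𝔗, ∑ i ∈ I T, ∫⁻ x in openFacet T i, ENNReal.ofReal (|Wf T i x| ^ p)
          ∂(area (n + 1)) := by
      calc ∫⁻ x, ENNReal.ofReal (|W x| ^ p) ∂(surface K)
          ≤ ∫⁻ x, ∑ T ∈ 𝔗, ∑ i ∈ I T, (openFacet T i).indicator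
              (fun x => ENNReal.ofReal (|Wf T i x| ^ p)) x ∂(surface K) := by
            refine lintegral_mono_ae ?_
            filter_upwards [h.ae_existsUnique] with x hx
            obtain ⟨hxK, T, hT, i, hiK, hi, huniq⟩ := hx
            rw [hWeq x T hT i hiK hi huniq]
            refine le_trans ?_ (Finset.single_le_sum (f := fun T => ∑ i ∈ I T,
              (openFacet T i).indicator (fun x => ENNReal.ofReal (|Wf T i x| ^ p)) x)
              (fun _ _ => zero_le) hT)
            refine le_trans ?_ (Finset.single_le_sum (f := fun i =>
              (openFacet T i).indicator (fun x => ENNReal.ofReal (|Wf T i x| ^ p)) x)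
              (fun _ _ => zero_le) (show i ∈ I T by simp [hI, hiK]))
            simp only [indicator_of_mem hi]; exact le_rfl
        _ ≤ ∫⁻ x, ∑ T ∈ 𝔗, ∑ i ∈ I T, (openFacet T i).indicator
              (fun x => ENNReal.ofReal (|Wf T i x| ^ p)) x ∂(area (n + 1)) :=
            lintegral_mono' Measure.restrict_le_self le_rfl
        _ = _ := by
            have hm : ∀ T ∈ 𝔗, ∀ i, Measurable ((openFacet T i).indicator
                (fun x => ENNReal.ofReal (|Wf T i x| ^ p))) := fun T hT i => by
              have := hWm T i hT
              exact Measurable.indicator (by fun_prop) (measurableSet_openFacet T i)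
            rw [lintegral_finsetSum _ fun T hT => Finset.measurable_fun_sum _ fun i _ => hm T hT i]
            refine Finset.sum_congr rfl fun T hT => ?_
            rw [lintegral_finsetSum _ fun i _ => hm T hT i]
            exact Finset.sum_congr rfl fun i _ =>
              lintegral_indicator (measurableSet_openFacet T i) _
    have hT : ∀ T ∈ 𝔗, ENNReal.ofReal (γ * Metric.diam K) *
        ∑ i ∈ I T, ∫⁻ x in openFacet T i, ENNReal.ofReal (|Wf T i x| ^ p) ∂(area (n + 1))
          ≤ ∫⁻ x in interior (body T), R x := by
      intro T hT
      rcases (I T).eq_empty_or_nonempty with he | ⟨i₀, hi₀⟩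
      · simp [he]
      have hsub : ∀ i ∈ I T, facet T i ⊆ frontier (body T) ∩ frontier K := fun i hi =>
        subset_inter (facet_subset_frontier T i) (Finset.mem_filter.1 hi).2
      have hreg := h.regular T hT ((nonempty_facet T i₀).mono (hsub i₀ hi₀))
      set A := area (n + 1) (frontier (body T) ∩ frontier K) with hA
      have hAsum : ∑ i ∈ I T, area (n + 1) (openFacet T i) ≤ A := by
        rw [← measure_biUnion_finset (fun i _ k _ hik => disjoint_openFacet T hik)
          fun i _ => measurableSet_openFacet T i]
        exact measure_mono (iUnion₂_subset fun i hi =>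
          (openFacet_subset_facet T i).trans (hsub i hi))
      calc _ ≤ (((n + 1 : ℕ) : ℝ≥0∞) * volume (body T) * A⁻¹) *
            ∑ i ∈ I T, ∫⁻ x in openFacet T i, ENNReal.ofReal (|Wf T i x| ^ p) ∂(area (n + 1)) :=
            mul_le_mul_left hreg _
        _ = A⁻¹ * ∑ i ∈ I T, (((n + 1 : ℕ) : ℝ≥0∞) * volume (body T) *
            ∫⁻ x in openFacet T i, ENNReal.ofReal (|Wf T i x| ^ p) ∂(area (n + 1))) := by
            rw [← Finset.mul_sum]; ring
        _ ≤ A⁻¹ * ∑ i ∈ I T, area (n + 1) (openFacet T i) * ∫⁻ x in interior (body T), R x := by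
            refine mul_le_mul_right (Finset.sum_le_sum fun i _ => ?_) _
            have := hWp T i hT p hp
            simpa only [hR, Nat.cast_add, Nat.cast_one] using this
        _ ≤ A⁻¹ * (A * ∫⁻ x in interior (body T), R x) := by
            rw [← Finset.sum_mul]
            exact mul_le_mul_right (mul_le_mul_left hAsum _) _
        _ ≤ 1 * ∫⁻ x in interior (body T), R x := by
            rw [← mul_assoc]
            exact mul_le_mul_left (ENNReal.inv_mul_le_one A) _
        _ = _ := one_mul _
    calc _ ≤ ENNReal.ofReal (γ * Metric.diam K) * ∑ T ∈ 𝔗, ∑ i ∈ I T,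
          ∫⁻ x in openFacet T i, ENNReal.ofReal (|Wf T i x| ^ p) ∂(area (n + 1)) :=
          mul_le_mul_right hsplit _
      _ ≤ ∑ T ∈ 𝔗, ∫⁻ x in interior (body T), R x := by
          rw [Finset.mul_sum]; exact Finset.sum_le_sum hT
      _ = ∫⁻ x in ⋃ T ∈ 𝔗, interior (body T), R x :=
          (lintegral_biUnion_finset (fun T hT T' hT' hne => h.disjoint T hT T' hT' hne)
            (fun T _ => isOpen_interior.measurableSet) _).symm
      _ ≤ ∫⁻ x in K, R x := lintegral_mono_set (iUnion₂_subset fun T hT =>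
          interior_subset.trans (h.body_subset hT))

/-- The trace is unique up to null sets. -/
theorem IsRegularPartition.trace_unique {d : ℕ} {γ : ℝ} {K : Set (E d)}
    {𝔗 : Finset (Affine.Simplex ℝ (E d) d)} (h : IsRegularPartition γ K 𝔗)
    {v w w' : E d → ℝ} (hv : IntegrableOn v K) (hw : IsTrace K v w) (hw' : IsTrace K v w') :
    w =ᵐ[surface K] w' := by
  have hmem : ∀ᵐ x ∂(surface K), x ∈ frontier K :=
    ae_restrict_mem isClosed_frontier.measurableSet
  filter_upwards [hw, hw', hmem] with x h1 h2 hx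
  have hxK : x ∈ K := h.isCompact.isClosed.frontier_subset hx
  obtain ⟨T, hT, hxT⟩ := h.exists_mem_body hxK
  obtain ⟨κ, hκ, hκv⟩ := exists_le_volume_body_inter_ball T hxT
  have h3 := h1.add h2
  rw [add_zero] at h3
  have hle : |w x - w' x| ≤ 0 := by
    refine ge_of_tendsto h3 ?_
    filter_upwards [hκv, self_mem_nhdsWithin] with r hr hr0
    have hr0' : (0 : ℝ) < r := hr0
    set S := K ∩ Metric.ball x r with hS
    have hSv : volume S ≠ 0 := by
      have h4 : κ * ENNReal.ofReal (r ^ d) ≤ volume S :=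
        hr.trans (measure_mono (inter_subset_inter_left _ (h.body_subset hT)))
      have h5 : κ * ENNReal.ofReal (r ^ d) ≠ 0 := mul_ne_zero hκ (by
        have := pow_pos hr0' d; simpa using this)
      exact fun h6 => h5 (le_antisymm (h6 ▸ h4) zero_le)
    have hSt : volume S ≠ ⊤ :=
      ((measure_mono inter_subset_right).trans_lt measure_ball_lt_top).ne
    have hi : ∀ c, IntegrableOn (fun y => |v y - c|) S := fun c =>
      ((hv.mono_set inter_subset_left).sub (integrableOn_const hSt)).abs
    rw [← setAverage_const hSv hSt (|w x - w' x|), setAverage_eq, setAverage_eq, setAverage_eq,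
      ← smul_add, ← integral_add (hi _) (hi _)]
    refine smul_le_smul_of_nonneg_left ?_ (inv_nonneg.2 measureReal_nonneg)
    refine integral_mono (integrableOn_const hSt) ((hi _).add (hi _)) fun y => ?_
    calc |w x - w' x| = |(v y - w' x) - (v y - w x)| := by congr 1; ring
      _ ≤ |v y - w' x| + |v y - w x| := abs_sub _ _
      _ = _ := add_comm _ _
  exact sub_eq_zero.1 (abs_nonpos_iff.1 hle)

theorem IsTrace.congr {d : ℕ} {K : Set (E d)} {v v' w : E d → ℝ}
    (hvv' : v =ᵐ[volume.restrict K] v') (h : IsTrace K v w) : IsTrace K v' w := by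
  filter_upwards [h] with x hx
  refine hx.congr fun r => ?_
  refine average_congr ?_
  filter_upwards [ae_restrict_of_ae_restrict_of_subset inter_subset_left hvv'] with y hy
  rw [hy]

theorem IsWeakGradient.congr {d : ℕ} {K : Set (E d)} {v v' : E d → ℝ} {g g' : E d → E d}
    (hvv' : v =ᵐ[volume.restrict K] v') (hgg' : g =ᵐ[volume.restrict K] g')
    (h : IsWeakGradient K v g) : IsWeakGradient K v' g' := by
  intro φ h1 h2 h3 e
  have h4 := h φ h1 h2 h3 e
  rw [integral_congr_ae (g := fun x => v' x * fderiv ℝ φ x e), integral_congr_ae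
    (f := fun x => inner ℝ (g x) e * φ x) (g := fun x => inner ℝ (g' x) e * φ x)] at h4
  · exact h4
  · filter_upwards [ae_restrict_of_ae_restrict_of_subset interior_subset hgg'] with y hy
    rw [hy]
  · filter_upwards [ae_restrict_of_ae_restrict_of_subset interior_subset hvv'] with y hy
    rw [hy]

end

/-! ### The trace constants and the inequalities -/

/-- Young's inequality in the form which produces the trace constants. -/
theorem mul_rpow_add_le {p a b c : ℝ} (hp : 1 ≤ p) (ha : 0 ≤ a) (hb : 0 ≤ b) (hc : 1 ≤ c) :
    c * a ^ p + p * (a ^ (p - 1) * b) ≤ (c + (p - 1)) * (a + b) ^ p := by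
  have hp0 : 0 < p := by linarith
  have h1 := Real.geom_mean_le_arith_mean2_weighted (w₁ := (p - 1) / p) (w₂ := 1 / p)
    (p₁ := a ^ p) (p₂ := b ^ p) (div_nonneg (by linarith) hp0.le) (by positivity)
    (by positivity) (by positivity) (by field_simp; ring)
  rw [← Real.rpow_mul ha, ← Real.rpow_mul hb, mul_div_cancel₀ _ hp0.ne',
    mul_one_div_cancel hp0.ne', Real.rpow_one] at h1
  have h2 : p * (a ^ (p - 1) * b) ≤ (p - 1) * a ^ p + b ^ p := by
    have h3 := mul_le_mul_of_nonneg_left h1 hp0.le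
    have h4 : p * ((p - 1) / p * a ^ p + 1 / p * b ^ p) = (p - 1) * a ^ p + b ^ p := by
      field_simp
    linarith
  have h5 := Real.add_rpow_le_rpow_add ha hb hp
  have h6 : 0 ≤ b ^ p := by positivity
  have h7 := mul_le_mul_of_nonneg_left h5 (by linarith : 0 ≤ c + (p - 1))
  nlinarith

theorem eLpNorm_ofReal {α F : Type*} [MeasurableSpace α] [NormedAddCommGroup F] {μ : Measure α}
    (f : α → F) {p : ℝ} (hp : 0 < p) :
    eLpNorm f (ENNReal.ofReal p) μ = (∫⁻ x, ‖f x‖ₑ ^ p ∂μ) ^ (1 / p) := by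
  rw [eLpNorm_eq_lintegral_rpow_enorm_toReal (by simpa using hp) ENNReal.ofReal_ne_top,
    ENNReal.toReal_ofReal hp.le]

theorem eLpNorm_ofReal_rpow {α F : Type*} [MeasurableSpace α] [NormedAddCommGroup F]
    {μ : Measure α} (f : α → F) {p : ℝ} (hp : 0 < p) :
    eLpNorm f (ENNReal.ofReal p) μ ^ p = ∫⁻ x, ‖f x‖ₑ ^ p ∂μ := by
  rw [eLpNorm_ofReal f hp, ← ENNReal.rpow_mul, one_div_mul_cancel hp.ne', ENNReal.rpow_one]

theorem ofReal_abs_rpow (x : ℝ) {p : ℝ} (hp : 0 ≤ p) :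
    ENNReal.ofReal (|x| ^ p) = ‖x‖ₑ ^ p := by
  rw [← ENNReal.ofReal_rpow_of_nonneg (abs_nonneg x) hp, ← Real.norm_eq_abs, ofReal_norm]

/-- Hölder's inequality applied to the right-hand side of the fundamental estimate. -/
theorem lintegral_trace_integrand_le {d : ℕ} {K : Set (E d)} {v : E d → ℝ} {g : E d → E d}
    (hvm : Measurable v) (hgm : Measurable g) {p q s h : ℝ} (hp : 1 ≤ p) (hq : 1 ≤ q)
    (hs : 0 < s) (hpqs : p - 1 = s * (1 - 1 / q)) (hh : 0 ≤ h) :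
    ∫⁻ x in K, ENNReal.ofReal ((d : ℝ) * |v x| ^ p + p * |v x| ^ (p - 1) * (h * ‖g x‖)) ≤
      ENNReal.ofReal d * eLpNorm v (ENNReal.ofReal p) (volume.restrict K) ^ p
        + ENNReal.ofReal (p * h) * (eLpNorm v (ENNReal.ofReal s) (volume.restrict K) ^ (p - 1)
          * eLpNorm g (ENNReal.ofReal q) (volume.restrict K)) := by
  have hp1 : 0 ≤ p - 1 := by linarith
  have hq0 : 0 < q := by linarith
  have hθ : 0 ≤ 1 - 1 / q := by
    rw [sub_nonneg, div_le_one hq0]; exact hq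
  have hpt : ∀ x, ENNReal.ofReal ((d : ℝ) * |v x| ^ p + p * |v x| ^ (p - 1) * (h * ‖g x‖))
      = ENNReal.ofReal d * ‖v x‖ₑ ^ p
        + ENNReal.ofReal (p * h) * ((‖v x‖ₑ ^ s) ^ (1 - 1 / q) * (‖g x‖ₑ ^ q) ^ (1 / q)) := by
    intro x
    rw [ENNReal.ofReal_add (by positivity) (by positivity), ENNReal.ofReal_mul (by positivity),
      ofReal_abs_rpow _ (by linarith), ← ENNReal.rpow_mul, ← ENNReal.rpow_mul, ← hpqs,
      mul_one_div_cancel hq0.ne', ENNReal.rpow_one, ← ofReal_abs_rpow _ hp1, ← ofReal_norm (g x),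
      ← ENNReal.ofReal_mul (by positivity), ← ENNReal.ofReal_mul (by positivity)]
    congr 2; ring
  simp only [hpt]
  rw [lintegral_add_left (by fun_prop), lintegral_const_mul _ (by fun_prop),
    lintegral_const_mul _ (by fun_prop), eLpNorm_ofReal_rpow v (by linarith)]
  gcongr
  refine (ENNReal.lintegral_mul_norm_pow_le (by fun_prop) (by fun_prop) hθ (by positivity)
    (by ring)).trans (le_of_eq ?_)
  rw [eLpNorm_ofReal v hs, eLpNorm_ofReal g hq0, ← ENNReal.rpow_mul, hpqs]
  congr 2
  field_simp

theorem eLpNorm_le_of_lintegral_le {d : ℕ} {μ : Measure (E d)} {w : E d → ℝ} {p A c m : ℝ}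
    (hp : 1 ≤ p) (hA : 0 < A) (hc : 0 ≤ c) (hm : 0 ≤ m)
    (h : ENNReal.ofReal A * ∫⁻ x, ENNReal.ofReal (|w x| ^ p) ∂μ
      ≤ ENNReal.ofReal (A * (c * m ^ p))) :
    eLpNorm w (ENNReal.ofReal p) μ ≤ ENNReal.ofReal (c ^ (1 / p)) * ENNReal.ofReal m := by
  have hp0 : 0 < p := by linarith
  rw [ENNReal.ofReal_mul hA.le, ENNReal.mul_le_mul_iff_right (by simpa using hA)
    ENNReal.ofReal_ne_top] at h
  rw [eLpNorm_ofReal w hp0]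
  simp only [ofReal_abs_rpow _ hp0.le] at h
  refine (ENNReal.rpow_le_rpow h (by positivity)).trans (le_of_eq ?_)
  rw [ENNReal.ofReal_rpow_of_nonneg (by positivity) (by positivity), ← ENNReal.ofReal_mul
    (by positivity), Real.mul_rpow hc (by positivity), ← Real.rpow_mul hm,
    mul_one_div_cancel hp0.ne', Real.rpow_one]

/-- `d ω_d ^ (1 / d) ≥ 1`, where `ω_d` is the volume of the unit ball. This is the hypothesis on `c`
in `mul_rpow_add_le` for the second inequality. -/
theorem one_le_mul_ballVolume {d : ℕ} (hd : 2 ≤ d) :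
    1 ≤ d * (Real.pi ^ ((d : ℝ) / 2) / Real.Gamma (d / 2 + 1)) ^ (1 / (d : ℝ)) := by
  have hd2 : (2 : ℝ) ≤ d := by exact_mod_cast hd
  have hd0 : (0 : ℝ) < d := by linarith
  have hΓ : 0 < Real.Gamma ((d : ℝ) / 2 + 1) := Real.Gamma_pos_of_pos (by positivity)
  have h1 : Real.Gamma ((d : ℝ) / 2 + 1) ≤ (d : ℝ) ^ d := by
    have h2 : Real.Gamma ((d : ℝ) / 2 + 1) ≤ Real.Gamma ((d : ℝ) + 1) :=
      Real.Gamma_strictMonoOn_Ici.monotoneOn (show (2 : ℝ) ≤ _ by linarith)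
        (show (2 : ℝ) ≤ _ by linarith) (by linarith)
    rw [Real.Gamma_nat_eq_factorial] at h2
    exact h2.trans (by exact_mod_cast Nat.factorial_le_pow d)
  have h3 : 1 ≤ Real.pi ^ ((d : ℝ) / 2) :=
    Real.one_le_rpow (by linarith [Real.pi_gt_three]) (by positivity)
  have h4 : ((d : ℝ) ^ d)⁻¹ ≤ Real.pi ^ ((d : ℝ) / 2) / Real.Gamma (d / 2 + 1) := by
    rw [le_div_iff₀ hΓ, inv_mul_le_iff₀ (by positivity)]
    nlinarith [pow_pos hd0 d]
  have h5 := Real.rpow_le_rpow (by positivity) h4 (show 0 ≤ 1 / (d : ℝ) by positivity)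
  have h6 : (((d : ℝ) ^ d)⁻¹) ^ (1 / (d : ℝ)) = (d : ℝ)⁻¹ := by
    rw [Real.inv_rpow (by positivity), ← Real.rpow_natCast, ← Real.rpow_mul hd0.le,
      mul_one_div_cancel hd0.ne', Real.rpow_one]
  rw [h6] at h5
  calc (1 : ℝ) = d * (d : ℝ)⁻¹ := (mul_inv_cancel₀ hd0.ne').symm
    _ ≤ _ := mul_le_mul_of_nonneg_left h5 hd0.le

/-- A set is contained in a ball with radius its diameter. -/
theorem volume_le_diam {d : ℕ} (hd : 2 ≤ d) {K : Set (E d)} (hK : Bornology.IsBounded K) :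
    volume K ≤ ENNReal.ofReal (Metric.diam K ^ (d : ℝ)
      * (Real.pi ^ ((d : ℝ) / 2) / Real.Gamma (d / 2 + 1))) := by
  rcases K.eq_empty_or_nonempty with rfl | ⟨x, hx⟩
  · simp
  have : Nonempty (Fin d) := ⟨⟨0, by omega⟩⟩
  have hsub : K ⊆ Metric.closedBall x (Metric.diam K) := fun y hy =>
    Metric.dist_le_diam_of_mem hK hy hx
  refine (measure_mono hsub).trans (le_of_eq ?_)
  rw [EuclideanSpace.volume_closedBall, Fintype.card_fin, ENNReal.ofReal_mul (by positivity),
    ← ENNReal.ofReal_pow Metric.diam_nonneg, Real.rpow_natCast]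
  congr 3
  rw [Real.sqrt_eq_rpow, ← Real.rpow_natCast, ← Real.rpow_mul Real.pi_pos.le]
  congr 1; ring

theorem IsRegularPartition.diam_pos {d : ℕ} (hd : 2 ≤ d) {γ : ℝ} {K : Set (E d)}
    {𝔗 : Finset (Affine.Simplex ℝ (E d) d)} (h : IsRegularPartition γ K 𝔗) (hne : K.Nonempty) :
    0 < Metric.diam K := by
  obtain ⟨x, hx⟩ := hne
  obtain ⟨T, hT, -⟩ := h.exists_mem_body hx
  have : NeZero d := ⟨by omega⟩
  obtain ⟨k, hk⟩ := exists_ne (0 : Fin (d + 1))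
  have hmem : ∀ l, T.points l ∈ K := fun l =>
    h.body_subset hT (subset_convexHull ℝ _ (mem_range_self l))
  exact (dist_pos.2 (T.independent.injective.ne hk)).trans_le
    (Metric.dist_le_diam_of_mem h.isCompact.isBounded (hmem k) (hmem 0))

theorem traceConst_self (q γ : ℝ) (d : ℕ) :
    traceConst q q d γ = ((d + (q - 1)) / γ) ^ (1 / q) := by
  simp [traceConst, add_div]

theorem traceConst_sharp {q γ : ℝ} (hq : 1 ≤ q) {d : ℕ} (hqd : q < d) :
    traceConst (qSharp q d) (qStar q d) d γ
      = ((d * (Real.pi ^ ((d : ℝ) / 2) / Real.Gamma (d / 2 + 1)) ^ (1 / (d : ℝ))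
          + (qSharp q d - 1)) / γ) ^ (1 / qSharp q d) := by
  have hd0 : (0 : ℝ) < d := by linarith
  have hdq : (d : ℝ) - q ≠ 0 := by linarith
  have hq0 : q ≠ 0 := by linarith
  have hΓ : 0 < Real.Gamma ((d : ℝ) / 2 + 1) := Real.Gamma_pos_of_pos (by positivity)
  have h1 : (qStar q d - qSharp q d) / qStar q d = 1 / d := by
    unfold qStar qSharp; field_simp; ring
  have h2 : (d : ℝ) * (qStar q d - qSharp q d) / (2 * qStar q d) = d / 2 * (1 / d) := by
    rw [← h1]
    unfold qStar qSharp; field_simp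
  rw [traceConst, h1, h2, Real.div_rpow (by positivity) hΓ.le, ← Real.rpow_mul Real.pi_pos.le]
  congr 1
  field_simp

end SobolevTrace

open SobolevTrace in
theorem corollary1p2 (d : ℕ) (hd : 2 ≤ d) (γ : ℝ) (hγ : 0 < γ) (q : ℝ) (hq : 1 ≤ q)
    (K : Set (SobolevTrace.E d)) (hK : SobolevTrace.IsRegularElement γ K)
    (v : SobolevTrace.E d → ℝ) (g : SobolevTrace.E d → SobolevTrace.E d)
    (hv : SobolevTrace.MemSobolev q K v g) :
    -- the trace of `v` exists and belongs to `L^q(∂K)`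
    (∃ w : SobolevTrace.E d → ℝ, SobolevTrace.IsTrace K v w ∧
      MemLp w (ENNReal.ofReal q) (SobolevTrace.surface K)) ∧
    -- and it satisfies the two inequalities
    ∀ w : SobolevTrace.E d → ℝ, SobolevTrace.IsTrace K v w →
      eLpNorm w (ENNReal.ofReal q) (SobolevTrace.surface K) ≤
        ENNReal.ofReal (SobolevTrace.traceConst q q d γ) *
          (ENNReal.ofReal (Metric.diam K ^ (-(1 / q))) *
              eLpNorm v (ENNReal.ofReal q) (volume.restrict K)
            + ENNReal.ofReal (Metric.diam K ^ (1 - 1 / q)) *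
              eLpNorm g (ENNReal.ofReal q) (volume.restrict K)) ∧
      (q < d →
        eLpNorm w (ENNReal.ofReal (SobolevTrace.qSharp q d)) (SobolevTrace.surface K) ≤
          ENNReal.ofReal (SobolevTrace.traceConst (SobolevTrace.qSharp q d)
              (SobolevTrace.qStar q d) d γ) *
            (eLpNorm v (ENNReal.ofReal (SobolevTrace.qStar q d)) (volume.restrict K)
              + eLpNorm g (ENNReal.ofReal q) (volume.restrict K))) := by
  obtain ⟨𝔗, h⟩ := hK
  rcases K.eq_empty_or_nonempty with rfl | hne
  · have hs : surface (∅ : Set (E d)) = 0 := by simp [surface]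
    refine ⟨⟨0, ?_, ?_⟩, fun w _ => ⟨?_, fun _ => ?_⟩⟩ <;> simp [IsTrace, hs]
  have hh := h.diam_pos hd hne
  set D := Metric.diam K with hD
  have hq0 : 0 < q := by linarith
  have hd2 : (2 : ℝ) ≤ d := by exact_mod_cast hd
  have hKb := h.isCompact.isBounded
  have : IsFiniteMeasure (volume.restrict K) :=
    ⟨by simpa using h.isCompact.measure_lt_top⟩
  have hq1 : 1 ≤ ENNReal.ofReal q := by simpa using hq
  -- measurable representatives of `v` and of its gradient
  set v' := hv.memLp.1.aemeasurable.mk v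
  set g' := hv.memLp_grad.1.aemeasurable.mk g
  have hvm : Measurable v' := hv.memLp.1.aemeasurable.measurable_mk
  have hgm : Measurable g' := hv.memLp_grad.1.aemeasurable.measurable_mk
  have hvv : v =ᵐ[volume.restrict K] v' := hv.memLp.1.aemeasurable.ae_eq_mk
  have hgg : g =ᵐ[volume.restrict K] g' := hv.memLp_grad.1.aemeasurable.ae_eq_mk
  have hvi : IntegrableOn v K := hv.memLp.integrable hq1
  have hgi : IntegrableOn g K := hv.memLp_grad.integrable hq1
  have hweak : IsWeakGradient K v' g' := hv.weakGradient.congr hvv hgg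
  obtain ⟨W, hWm, hWt, hWp⟩ : ∃ W : E d → ℝ, Measurable W ∧ IsTrace K v' W ∧
      ∀ p : ℝ, 1 ≤ p → ENNReal.ofReal (γ * D) * ∫⁻ x, ENNReal.ofReal (|W x| ^ p) ∂(surface K) ≤
        ∫⁻ x in K, ENNReal.ofReal ((d : ℝ) * |v' x| ^ p
          + p * |v' x| ^ (p - 1) * (D * ‖g' x‖)) := by
    obtain ⟨n, rfl⟩ : ∃ n, d = n + 1 := ⟨d - 1, by omega⟩
    exact h.exists_trace hvm hgm (hvi.congr hvv) (hgi.congr hgg) hweak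
  have hWt' : IsTrace K v W := hWt.congr hvv.symm
  have hB : eLpNorm g (ENNReal.ofReal q) (volume.restrict K) ≠ ⊤ := hv.memLp_grad.2.ne
  have hA : eLpNorm v (ENNReal.ofReal q) (volume.restrict K) ≠ ⊤ := hv.memLp.2.ne
  have hγD : 0 < γ * D := mul_pos hγ hh
  have ineq1 : eLpNorm W (ENNReal.ofReal q) (surface K) ≤
        ENNReal.ofReal (traceConst q q d γ) *
          (ENNReal.ofReal (D ^ (-(1 / q))) * eLpNorm v (ENNReal.ofReal q) (volume.restrict K)
            + ENNReal.ofReal (D ^ (1 - 1 / q)) *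
              eLpNorm g (ENNReal.ofReal q) (volume.restrict K)) := by
    set A := (eLpNorm v (ENNReal.ofReal q) (volume.restrict K)).toReal
    set B := (eLpNorm g (ENNReal.ofReal q) (volume.restrict K)).toReal
    have hA' : eLpNorm v (ENNReal.ofReal q) (volume.restrict K) = ENNReal.ofReal A :=
      (ENNReal.ofReal_toReal hA).symm
    have hB' : eLpNorm g (ENNReal.ofReal q) (volume.restrict K) = ENNReal.ofReal B :=
      (ENNReal.ofReal_toReal hB).symm
    have hA0 : 0 ≤ A := ENNReal.toReal_nonneg
    have hB0 : 0 ≤ B := ENNReal.toReal_nonneg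
    have h1 := (hWp q hq).trans (lintegral_trace_integrand_le hvm hgm hq hq hq0
      (by field_simp) hh.le)
    rw [← eLpNorm_congr_ae hvv, ← eLpNorm_congr_ae hgg] at h1
    rw [hA', hB'] at h1 ⊢
    rw [ENNReal.ofReal_rpow_of_nonneg hA0 hq0.le, ENNReal.ofReal_rpow_of_nonneg hA0
      (by linarith), ← ENNReal.ofReal_mul (by positivity), ← ENNReal.ofReal_mul (by positivity),
      ← ENNReal.ofReal_mul (by positivity), ← ENNReal.ofReal_add (by positivity)
      (by positivity)] at h1
    rw [← ENNReal.ofReal_mul (by positivity), ← ENNReal.ofReal_mul (by positivity),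
      ← ENNReal.ofReal_add (by positivity) (by positivity), traceConst_self]
    refine eLpNorm_le_of_lintegral_le hq hγD (div_nonneg (by linarith) hγ.le) (by positivity)
      (h1.trans (ENNReal.ofReal_le_ofReal ?_))
    have hy := mul_rpow_add_le (a := D ^ (-(1 / q)) * A) (b := D ^ (1 - 1 / q) * B) (c := d) hq
      (by positivity) (by positivity) (by linarith)
    have ha : (D ^ (-(1 / q)) * A) ^ q = D⁻¹ * A ^ q := by
      rw [Real.mul_rpow (by positivity) hA0, ← Real.rpow_mul hh.le, neg_mul,
        one_div_mul_cancel hq0.ne', Real.rpow_neg_one]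
    have hab : (D ^ (-(1 / q)) * A) ^ (q - 1) * (D ^ (1 - 1 / q) * B) = A ^ (q - 1) * B := by
      rw [Real.mul_rpow (by positivity) hA0, ← Real.rpow_mul hh.le]
      have : D ^ (-(1 / q) * (q - 1)) * D ^ (1 - 1 / q) = 1 := by
        rw [← Real.rpow_add hh, show -(1 / q) * (q - 1) + (1 - 1 / q) = 0 by field_simp; ring,
          Real.rpow_zero]
      linear_combination (A ^ (q - 1) * B) * this
    rw [ha, hab] at hy
    calc (d : ℝ) * A ^ q + q * D * (A ^ (q - 1) * B)
        = D * (d * (D⁻¹ * A ^ q) + q * (A ^ (q - 1) * B)) := by field_simp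
      _ ≤ D * ((d + (q - 1)) * (D ^ (-(1 / q)) * A + D ^ (1 - 1 / q) * B) ^ q) :=
          mul_le_mul_of_nonneg_left hy hh.le
      _ = _ := by field_simp
  have ineq2 : q < d → eLpNorm W (ENNReal.ofReal (qSharp q d)) (surface K) ≤
          ENNReal.ofReal (traceConst (qSharp q d) (qStar q d) d γ) *
            (eLpNorm v (ENNReal.ofReal (qStar q d)) (volume.restrict K)
              + eLpNorm g (ENNReal.ofReal q) (volume.restrict K)) := by
    intro hqd
    have hdq : 0 < (d : ℝ) - q := by linarith
    set p := qSharp q d with hp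
    set s := qStar q d with hs
    set c := d * (Real.pi ^ ((d : ℝ) / 2) / Real.Gamma (d / 2 + 1)) ^ (1 / (d : ℝ)) with hc
    have hc1 : 1 ≤ c := one_le_mul_ballVolume hd
    have hp1 : 1 ≤ p := by
      rw [hp, qSharp, le_div_iff₀ hdq]; nlinarith
    have hs0 : 0 < s := by rw [hs, qStar]; positivity
    have hps : p - 1 = s * (1 - 1 / q) := by
      rw [hp, hs, qSharp, qStar]; field_simp; ring
    have hps' : 1 / p - 1 / s = 1 / (d * p) := by
      have : (d : ℝ) - 1 ≠ 0 := by linarith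
      rw [hp, hs, qSharp, qStar]; field_simp; ring
    have hple : p ≤ s := by
      rw [hp, hs, qSharp, qStar, div_le_div_iff_of_pos_right hdq]; nlinarith
    have hC : 0 < (c + (p - 1)) / γ := div_pos (by linarith) hγ
    have hconst : traceConst p s d γ = ((c + (p - 1)) / γ) ^ (1 / p) := traceConst_sharp hq hqd
    rw [hconst]
    by_cases hA2 : eLpNorm v (ENNReal.ofReal s) (volume.restrict K) = ⊤
    · rw [hA2, top_add, ENNReal.mul_top]
      · exact le_top
      · have := Real.rpow_pos_of_pos hC (1 / p)
        simpa using this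
    set A := (eLpNorm v (ENNReal.ofReal s) (volume.restrict K)).toReal
    set B := (eLpNorm g (ENNReal.ofReal q) (volume.restrict K)).toReal
    have hA' : eLpNorm v (ENNReal.ofReal s) (volume.restrict K) = ENNReal.ofReal A :=
      (ENNReal.ofReal_toReal hA2).symm
    have hB' : eLpNorm g (ENNReal.ofReal q) (volume.restrict K) = ENNReal.ofReal B :=
      (ENNReal.ofReal_toReal hB).symm
    have hA0 : 0 ≤ A := ENNReal.toReal_nonneg
    have hB0 : 0 ≤ B := ENNReal.toReal_nonneg
    have hp0 : 0 < p := by linarith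
    have hd0 : (0 : ℝ) < d := by linarith
    -- the `L^p` norm of `v` on `K` is controlled by the `L^s` norm and the volume of `K`
    have hvol : eLpNorm v (ENNReal.ofReal p) (volume.restrict K) ^ p
        ≤ ENNReal.ofReal (D * (c / d) * A ^ p) := by
      have h1 := eLpNorm_le_eLpNorm_mul_rpow_measure_univ (μ := volume.restrict K)
        (ENNReal.ofReal_le_ofReal hple) hv.memLp.1
      rw [ENNReal.toReal_ofReal hp0.le, ENNReal.toReal_ofReal hs0.le, hps',
        Measure.restrict_apply_univ, hA'] at h1
      refine (ENNReal.rpow_le_rpow h1 hp0.le).trans ?_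
      rw [ENNReal.mul_rpow_of_nonneg _ _ hp0.le, ← ENNReal.rpow_mul,
        show 1 / (d * p) * p = 1 / (d : ℝ) by field_simp,
        ENNReal.ofReal_rpow_of_nonneg hA0 hp0.le, mul_comm, ENNReal.ofReal_mul (by positivity)]
      gcongr
      have hΓ : 0 < Real.Gamma ((d : ℝ) / 2 + 1) := Real.Gamma_pos_of_pos (by positivity)
      refine (ENNReal.rpow_le_rpow (volume_le_diam hd hKb) (by positivity)).trans (le_of_eq ?_)
      rw [ENNReal.ofReal_rpow_of_nonneg (by positivity) (by positivity),
        Real.mul_rpow (by positivity) (by positivity), ← Real.rpow_mul hh.le,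
        mul_one_div_cancel hd0.ne', Real.rpow_one, hc, mul_div_cancel_left₀ _ hd0.ne']
    have h1 := (hWp p hp1).trans (lintegral_trace_integrand_le hvm hgm hp1 hq hs0 hps hh.le)
    rw [← eLpNorm_congr_ae hvv, ← eLpNorm_congr_ae hgg, ← eLpNorm_congr_ae hvv] at h1
    have h2 := h1.trans (add_le_add (mul_le_mul_right hvol _) le_rfl)
    rw [hA', hB'] at h2 ⊢
    rw [ENNReal.ofReal_rpow_of_nonneg hA0 (by linarith), ← ENNReal.ofReal_mul (by positivity),
      ← ENNReal.ofReal_mul (by positivity), ← ENNReal.ofReal_mul (by positivity),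
      ← ENNReal.ofReal_add (by positivity) (by positivity)] at h2
    rw [← ENNReal.ofReal_add hA0 hB0]
    refine eLpNorm_le_of_lintegral_le hp1 hγD hC.le (by positivity)
      (h2.trans (ENNReal.ofReal_le_ofReal ?_))
    have hy := mul_rpow_add_le hp1 hA0 hB0 hc1
    calc (d : ℝ) * (D * (c / d) * A ^ p) + p * D * (A ^ (p - 1) * B)
        = D * (c * A ^ p + p * (A ^ (p - 1) * B)) := by field_simp
      _ ≤ D * ((c + (p - 1)) * (A + B) ^ p) := mul_le_mul_of_nonneg_left hy hh.le
      _ = _ := by field_simp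
  refine ⟨⟨W, hWt', hWm.aestronglyMeasurable, ineq1.trans_lt ?_⟩, fun w hw => ?_⟩
  · exact ENNReal.mul_lt_top ENNReal.ofReal_lt_top (ENNReal.add_lt_top.2
      ⟨ENNReal.mul_lt_top ENNReal.ofReal_lt_top hA.lt_top,
        ENNReal.mul_lt_top ENNReal.ofReal_lt_top hB.lt_top⟩)
  · have hwW := h.trace_unique hvi hw hWt'
    rw [eLpNorm_congr_ae hwW, eLpNorm_congr_ae hwW]
    exact ⟨ineq1, ineq2⟩
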